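/- Let $\mathbf x\in\mathbb R^{n_x}$, $\mathbf y\in\mathbb R^{n_y}$, $\mathbf z\in\mathbb R^{n_z}$ be jointly Gaussian random vectors. For random vectors $\mathbf a,\mathbf b$ with $\mathbf a$ square integrable, write $$\Sigma_{\mathbf a|\mathbf b}=E\big[(\mathbf a-E[\mathbf a|\mathbf b])(\mathbf a-E[\mathbf a|\mathbf b])^T\big]$$ for the covariance matrix of the error of the conditional-mean reconstruction of $\mathbf a$ from $\mathbf b$; write $A\succ B$ ($A\succeq B$) if $A-B$ is symmetric positive definite (semidefinite), $|A|$ for the determinant, and $\log$ for the natural logarithm. For symmetric positive definite $n\times n$ matrices $\Sigma_1,\Sigma_2$, let $\Sigma_1=U^T\Lambda U$ be an eigenvalue decomposition with $U$ orthogonal and $\Lambda=\mathrm{diag}(\lambda_1\ge\dots\ge\lambda_n)$, let $\Sigma_1^{1/2}=U^T\Lambda^{1/2}U$, let $\Sigma_1^{-1/2}\Sigma_2\Sigma_1^{-1/2}=W^T\Gamma W$ be an eigenvalue decomposition with $W$ orthogonal and $\Gamma=\mathrm{diag}(\gamma_1\ge\dots\ge\gamma_n)$, and put $V=\Lambda^{1/2}W\Sigma_1^{-1/2}$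 and $\lambda'_i=\lambda_i\gamma_i$, so that $V\Sigma_1V^T=\Lambda$ and $V\Sigma_2V^T=\mathrm{diag}(\lambda'_i)$. The minimum of the pair is $$\min(\Sigma_1,\Sigma_2)=V^{-1}\,\mathrm{diag}\{\min(\lambda_i,\lambda'_i)\}\,V^{-T},$$ which does not depend on the decompositions chosen. Assume $\Sigma_{\mathbf x|\mathbf z}-\Sigma_{\mathbf x|\mathbf y\mathbf z}$ is positive definite, and let $D\succ\Sigma_{\mathbf x|\mathbf y\mathbf z}$. Then the information rate-distortion function $$R(D)=\min_{\mathbf u} I(\mathbf y;\mathbf u|\mathbf z)\quad\text{subject to}\quad \Sigma_{\mathbf x|\mathbf u\mathbf z}\preceq D,\qquad \mathbf u\leftrightarrow\mathbf y\leftrightarrow(\mathbf x,\mathbf z),$$ where $\mathbf u$ ranges over all random vectors (of any finite dimension and any law, jointly distributed with $(\mathbf x,\mathbf y,\mathbf z)$) that are conditionally independent of $(\mathbf x,\mathbf z)$ given $\mathbf y$, is attained and equals $$R(D)=\frac12\log\frac{\left|\Sigma_{\mathbf x|\mathbf z}-\Sigma_{\mathbf x|\mathbf y\mathbf z}\right|}{\left|\min\left(D-\Sigma_{\mathbf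 x|\mathbf y\mathbf z},\ \Sigma_{\mathbf x|\mathbf z}-\Sigma_{\mathbf x|\mathbf y\mathbf z}\right)\right|}.$$ The minimum is attained and has the same value if the distortion constraint is instead imposed almost surely on the conditional covariance matrix $E\big[(\mathbf x-E[\mathbf x|\mathbf u,\mathbf z])(\mathbf x-E[\mathbf x|\mathbf u,\mathbf z])^T\,\big|\,\mathbf u,\mathbf z\big]$. -/

import Mathlib

open MeasureTheory ProbabilityTheory Matrix

namespace RemoteWynerZiv

/-! ### Minimum of two positive definite matrices -/

/-- `V` is a joint diagonalizer of the ordered pair `(S₁, S₂)`, with `V S₁ Vᵀ = diag lam` and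
`V S₂ Vᵀ = diag lam'`. Here `S₁ = Uᵀ (diag lam) U` is an eigenvalue decomposition with eigenvalues in
decreasing order, `R = Uᵀ (diag √lam) U` is the principal square root of `S₁`,
`R⁻¹ S₂ R⁻¹ = Wᵀ (diag gam) W` is an eigenvalue decomposition with eigenvalues in decreasing order,
`V = (diag √lam) W R⁻¹` and `lam' = lam * gam`. -/
def IsJointDiagonalizer {n : ℕ} (S₁ S₂ V : Matrix (Fin n) (Fin n) ℝ) (lam lam' : Fin n → ℝ) :
    Prop :=
  ∃ (U W R : Matrix (Fin n) (Fin n) ℝ) (gam : Fin n → ℝ),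
    U ∈ orthogonalGroup (Fin n) ℝ ∧ W ∈ orthogonalGroup (Fin n) ℝ ∧
    Antitone lam ∧ Antitone gam ∧
    S₁ = Uᵀ * diagonal lam * U ∧
    R = Uᵀ * diagonal (fun i => √(lam i)) * U ∧
    R⁻¹ * S₂ * R⁻¹ = Wᵀ * diagonal gam * W ∧
    V = diagonal (fun i => √(lam i)) * W * R⁻¹ ∧
    lam' = fun i => lam i * gam i

/-- `M = V⁻¹ diag (min (lam i, lam' i)) V⁻ᵀ` for a joint diagonalizer `V` of `(S₁, S₂)`. -/
def IsMatrixMin {n : ℕ} (S₁ S₂ M : Matrix (Fin n) (Fin n) ℝ) : Prop :=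
  ∃ (V : Matrix (Fin n) (Fin n) ℝ) (lam lam' : Fin n → ℝ),
    IsJointDiagonalizer S₁ S₂ V lam lam' ∧
    M = V⁻¹ * diagonal (fun i => min (lam i) (lam' i)) * (V⁻¹)ᵀ

open Classical in
/-- The minimum of the pair `(S₁, S₂)`. For symmetric positive definite matrices it exists and does
not depend on the eigenvalue decompositions chosen, see `isMatrixMin_iff` (for other pairs the value
is irrelevant). -/
noncomputable def matrixMin {n : ℕ} (S₁ S₂ : Matrix (Fin n) (Fin n) ℝ) :
    Matrix (Fin n) (Fin n) ℝ :=
  if h : ∃ M, IsMatrixMin S₁ S₂ M then h.choose else 0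

theorem exists_sorted_spectral {n : ℕ} {A : Matrix (Fin n) (Fin n) ℝ} (hA : A.IsHermitian) :
    ∃ (U : Matrix (Fin n) (Fin n) ℝ) (d : Fin n → ℝ),
      U ∈ orthogonalGroup (Fin n) ℝ ∧ Antitone d ∧ A = Uᵀ * diagonal d * U := by
  have hs := hA.spectral_theorem
  rw [Unitary.conjStarAlgAut_apply] at hs
  set Q : Matrix (Fin n) (Fin n) ℝ := (hA.eigenvectorUnitary : Matrix (Fin n) (Fin n) ℝ) with hQ
  have hQm : Q ∈ orthogonalGroup (Fin n) ℝ := hA.eigenvectorUnitary.2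
  have hQ1 : Q * Qᵀ = 1 := (mem_orthogonalGroup_iff (Fin n) ℝ).1 hQm
  have hQ2 : Qᵀ * Q = 1 := (mem_orthogonalGroup_iff' (Fin n) ℝ).1 hQm
  let σ : Equiv.Perm (Fin n) := Tuple.sort (fun i => -hA.eigenvalues i)
  have hσ : Monotone ((fun i => -hA.eigenvalues i) ∘ σ) := Tuple.monotone_sort _
  refine ⟨(Q.submatrix id σ)ᵀ, fun i => hA.eigenvalues (σ i), ?_, ?_, ?_⟩
  · rw [mem_orthogonalGroup_iff, transpose_transpose, transpose_submatrix,
      ← submatrix_mul Qᵀ Q σ id σ Function.bijective_id, hQ2]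
    exact submatrix_one_equiv σ
  · intro i j hij
    have := hσ hij
    simp only [Function.comp] at this
    linarith
  · have e1 : diagonal (fun i => hA.eigenvalues (σ i))
        = (diagonal hA.eigenvalues).submatrix σ σ := by
      rw [submatrix_diagonal_equiv]; rfl
    rw [transpose_transpose, transpose_submatrix, e1,
      ← submatrix_mul Q _ id σ σ σ.bijective, ← submatrix_mul _ Qᵀ id σ id σ.bijective]
    simpa [star_eq_conjTranspose] using hs

theorem spectral_apply_unique {n : ℕ} {U U' : Matrix (Fin n) (Fin n) ℝ} {d d' : Fin n → ℝ}
    (hU : U ∈ orthogonalGroup (Fin n) ℝ) (hU' : U' ∈ orthogonalGroup (Fin n) ℝ)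
    (h : Uᵀ * diagonal d * U = U'ᵀ * diagonal d' * U') (f : ℝ → ℝ) :
    Uᵀ * diagonal (fun i => f (d i)) * U = U'ᵀ * diagonal (fun i => f (d' i)) * U' := by
  have a1 : U * Uᵀ = 1 := (mem_orthogonalGroup_iff (Fin n) ℝ).1 hU
  have a2 : Uᵀ * U = 1 := (mem_orthogonalGroup_iff' (Fin n) ℝ).1 hU
  have b1 : U' * U'ᵀ = 1 := (mem_orthogonalGroup_iff (Fin n) ℝ).1 hU'
  have b2 : U'ᵀ * U' = 1 := (mem_orthogonalGroup_iff' (Fin n) ℝ).1 hU'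
  have key : diagonal d * (U * U'ᵀ) = (U * U'ᵀ) * diagonal d' := by
    calc diagonal d * (U * U'ᵀ) = (U * Uᵀ) * diagonal d * U * U'ᵀ := by
          rw [a1, one_mul, mul_assoc]
      _ = U * (Uᵀ * diagonal d * U) * U'ᵀ := by simp only [mul_assoc]
      _ = U * U'ᵀ * diagonal d' * (U' * U'ᵀ) := by rw [h]; simp only [mul_assoc]
      _ = _ := by rw [b1, mul_one]
  have key2 : diagonal (fun i => f (d i)) * (U * U'ᵀ)
      = (U * U'ᵀ) * diagonal (fun i => f (d' i)) := by
    ext i j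
    have := congrFun (congrFun key i) j
    rw [diagonal_mul, mul_diagonal] at this ⊢
    by_cases h0 : (U * U'ᵀ) i j = 0
    · simp [h0]
    · have : d i = d' j := mul_right_cancel₀ h0 (by rw [this, mul_comm])
      rw [this, mul_comm]
  calc Uᵀ * diagonal (fun i => f (d i)) * U
      = Uᵀ * (diagonal (fun i => f (d i)) * (U * U'ᵀ)) * U' := by
        simp only [mul_assoc]; rw [b2, mul_one]
    _ = (Uᵀ * U) * U'ᵀ * diagonal (fun i => f (d' i)) * U' := by
        rw [key2]; simp only [mul_assoc]
    _ = _ := by rw [a2, one_mul]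

theorem min_eq_of_diagonalizer {n : ℕ} {S₁ V : Matrix (Fin n) (Fin n) ℝ}
    {lam lam' : Fin n → ℝ} (h₁ : S₁.PosDef) {U W R : Matrix (Fin n) (Fin n) ℝ} {gam : Fin n → ℝ}
    (hU : U ∈ orthogonalGroup (Fin n) ℝ) (hW : W ∈ orthogonalGroup (Fin n) ℝ)
    (hS : S₁ = Uᵀ * diagonal lam * U) (hR : R = Uᵀ * diagonal (fun i => √(lam i)) * U)
    (hV : V = diagonal (fun i => √(lam i)) * W * R⁻¹) (hl : lam' = fun i => lam i * gam i) :
    V⁻¹ * diagonal (fun i => min (lam i) (lam' i)) * (V⁻¹)ᵀ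
      = R * (Wᵀ * diagonal (fun i => min 1 (gam i)) * W) * R := by
  have a1 : U * Uᵀ = 1 := (mem_orthogonalGroup_iff (Fin n) ℝ).1 hU
  have a2 : Uᵀ * U = 1 := (mem_orthogonalGroup_iff' (Fin n) ℝ).1 hU
  have c1 : W * Wᵀ = 1 := (mem_orthogonalGroup_iff (Fin n) ℝ).1 hW
  have c2 : Wᵀ * W = 1 := (mem_orthogonalGroup_iff' (Fin n) ℝ).1 hW
  have hpos : ∀ i, 0 < lam i := by
    have : (diagonal lam).PosDef := by
      have e : diagonal lam = U * S₁ * Uᴴ := by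
        rw [hS, conjTranspose_eq_transpose_of_trivial]
        calc diagonal lam = (U * Uᵀ) * diagonal lam * (U * Uᵀ) := by simp [a1]
          _ = _ := by simp only [mul_assoc]
      rw [e]
      refine h₁.mul_mul_conjTranspose_same ?_
      intro x y hxy
      have := congrArg (fun v => v ᵥ* Uᵀ) hxy
      simpa [vecMul_vecMul, a1] using this
    exact fun i => by simpa using (posDef_diagonal_iff.1 this) i
  have hs : ∀ i, √(lam i) ≠ 0 := fun i => (Real.sqrt_pos.2 (hpos i)).ne'
  have hRT : Rᵀ = R := by rw [hR]; simp [transpose_mul, mul_assoc]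
  set L := diagonal (fun i => √(lam i)) with hL
  set L' := diagonal (fun i => (√(lam i))⁻¹) with hL'
  have l1 : L * L' = 1 := by
    rw [hL, hL', diagonal_mul_diagonal]; simp [hs]
  have l2 : L' * L = 1 := by
    rw [hL, hL', diagonal_mul_diagonal]; simp [hs]
  have r1 : R * (Uᵀ * L' * U) = 1 := by
    rw [hR]
    calc Uᵀ * L * U * (Uᵀ * L' * U) = Uᵀ * L * (U * Uᵀ) * L' * U := by simp only [mul_assoc]
      _ = Uᵀ * (L * L') * U := by rw [a1, mul_one]; simp only [mul_assoc]
      _ = 1 := by rw [l1, mul_one, a2]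
  have hRi : R⁻¹ * R = 1 := by rw [inv_eq_right_inv r1]; exact mul_eq_one_comm.1 r1
  have hVi : V⁻¹ = R * Wᵀ * L' := by
    apply inv_eq_right_inv
    rw [hV]
    calc L * W * R⁻¹ * (R * Wᵀ * L') = L * W * (R⁻¹ * R) * Wᵀ * L' := by simp only [mul_assoc]
      _ = L * (W * Wᵀ) * L' := by rw [hRi, mul_one]; simp only [mul_assoc]
      _ = 1 := by rw [c1, mul_one, l1]
  have hd : L' * diagonal (fun i => min (lam i) (lam' i)) * L'
      = diagonal (fun i => min 1 (gam i)) := by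
    rw [hL', diagonal_mul_diagonal, diagonal_mul_diagonal]
    congr 1; ext i
    have e : min (lam i) (lam' i) = lam i * min 1 (gam i) := by
      rw [hl, mul_min_of_nonneg _ _ (hpos i).le, mul_one]
    have hq : √(lam i) * √(lam i) = lam i := Real.mul_self_sqrt (hpos i).le
    rw [e]
    nth_rewrite 2 [← hq]
    have := hs i
    field_simp
  have hLT : L'ᵀ = L' := by simp [hL']
  rw [hVi, transpose_mul, transpose_mul, transpose_transpose, hRT, hLT, ← hd]
  simp only [mul_assoc]

theorem exists_isMatrixMin {n : ℕ} {S₁ S₂ : Matrix (Fin n) (Fin n) ℝ} (h₁ : S₁.PosDef)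
    (h₂ : S₂.PosDef) : ∃ M, IsMatrixMin S₁ S₂ M := by
  obtain ⟨U, lam, hU, hlam, hS⟩ := exists_sorted_spectral h₁.1
  obtain ⟨R, hR⟩ : ∃ R, R = Uᵀ * diagonal (fun i => √(lam i)) * U := ⟨_, rfl⟩
  have hRT : Rᴴ = R := by
    rw [conjTranspose_eq_transpose_of_trivial, hR]; simp [transpose_mul, mul_assoc]
  have hB : (R⁻¹ * S₂ * R⁻¹).IsHermitian := by
    rw [IsHermitian, conjTranspose_mul, conjTranspose_mul, conjTranspose_nonsing_inv, hRT,
      h₂.1.eq, mul_assoc]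
  obtain ⟨W, gam, hW, hgam, hG⟩ := exists_sorted_spectral hB
  exact ⟨_, _, lam, _, ⟨U, W, R, gam, hU, hW, hlam, hgam, hS, hR, hG, rfl, rfl⟩, rfl⟩

theorem isMatrixMin_iff {n : ℕ} {S₁ S₂ M : Matrix (Fin n) (Fin n) ℝ} (h₁ : S₁.PosDef)
    (h₂ : S₂.PosDef) : IsMatrixMin S₁ S₂ M ↔ M = matrixMin S₁ S₂ := by
  have hex := exists_isMatrixMin h₁ h₂
  have hspec : IsMatrixMin S₁ S₂ (matrixMin S₁ S₂) := by
    rw [matrixMin, dif_pos hex]; exact hex.choose_spec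
  refine ⟨fun h => ?_, fun h => h ▸ hspec⟩
  obtain ⟨V, lam, lam', ⟨U, W, R, gam, hU, hW, -, -, hS, hR, hG, hV, hl⟩, hM⟩ := h
  obtain ⟨V', mu, mu', ⟨U', W', R', gam', hU', hW', -, -, hS', hR', hG', hV', hl'⟩, hM'⟩ := hspec
  rw [hM, hM', min_eq_of_diagonalizer h₁ hU hW hS hR hV hl,
    min_eq_of_diagonalizer h₁ hU' hW' hS' hR' hV' hl']
  have hRR : R = R' := by
    rw [hR, hR']; exact spectral_apply_unique hU hU' (hS.symm.trans hS') Real.sqrt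
  subst hRR
  rw [spectral_apply_unique hW hW' (hG.symm.trans hG') (fun t => min 1 t)]

/-! ### Conditional covariances and conditional mutual information -/

/-- The `i`-th coordinate of `X - E[X | W]`. -/
noncomputable def residual {Ω β : Type} [MeasurableSpace Ω] [mβ : MeasurableSpace β] {n : ℕ}
    (P : Measure Ω) (X : Ω → EuclideanSpace ℝ (Fin n)) (W : Ω → β) (i : Fin n) : Ω → ℝ :=
  fun ω => X ω i - (P[fun ω' => X ω' i | mβ.comap W]) ω

/-- The covariance matrix `E[(X - E[X|W]) (X - E[X|W])ᵀ]` of the error of the optimal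
(conditional mean) reconstruction of `X` from `W`. -/
noncomputable def condCov {Ω β : Type} [MeasurableSpace Ω] [MeasurableSpace β] {n : ℕ}
    (P : Measure Ω) (X : Ω → EuclideanSpace ℝ (Fin n)) (W : Ω → β) : Matrix (Fin n) (Fin n) ℝ :=
  Matrix.of fun i j => ∫ ω, residual P X W i ω * residual P X W j ω ∂P

/-- The random conditional covariance matrix `E[(X - E[X|W]) (X - E[X|W])ᵀ | W]`. -/
noncomputable def condCovGiven {Ω β : Type} [MeasurableSpace Ω] [mβ : MeasurableSpace β] {n : ℕ}
    (P : Measure Ω) (X : Ω → EuclideanSpace ℝ (Fin n)) (W : Ω → β) (ω : Ω) :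
    Matrix (Fin n) (Fin n) ℝ :=
  Matrix.of fun i j =>
    (P[fun ω' => residual P X W i ω' * residual P X W j ω' | mβ.comap W]) ω

/-- The conditional mutual information `I(Y; U | Z)` in nats: the Kullback-Leibler divergence of the
joint law of `(Z, (Y, U))` from the law under which `Z` has the same distribution, `Y` and `U` have
the same conditional distributions given `Z`, and `Y` and `U` are conditionally independent given
`Z`. -/
noncomputable def condMutualInfo {Ω α β γ : Type} [MeasurableSpace Ω]
    [MeasurableSpace α] [StandardBorelSpace α] [Nonempty α]
    [MeasurableSpace β] [StandardBorelSpace β] [Nonempty β] [MeasurableSpace γ]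
    (P : Measure Ω) [IsFiniteMeasure P] (Y : Ω → α) (U : Ω → β) (Z : Ω → γ) : ENNReal :=
  InformationTheory.klDiv (P.map fun ω => (Z ω, (Y ω, U ω)))
    (P.map Z ⊗ₘ (condDistrib Y Z P ×ₖ condDistrib U Z P))

/-! ### The remote Wyner-Ziv problem -/

/-- Values of the triple `(x, y, z)`: desired source, encoder observation, side information. -/
abbrev Src (nx ny nz : ℕ) : Type :=
  EuclideanSpace ℝ (Fin nx) × EuclideanSpace ℝ (Fin ny) × EuclideanSpace ℝ (Fin nz)

/-- `Σ_{x|z}` when `(x, y, z)` has law `μ`. -/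
noncomputable def covXZ {nx ny nz : ℕ} (μ : Measure (Src nx ny nz)) :
    Matrix (Fin nx) (Fin nx) ℝ :=
  condCov μ (fun p => p.1) (fun p => p.2.2)

/-- `Σ_{x|yz}` when `(x, y, z)` has law `μ`. -/
noncomputable def covXYZ {nx ny nz : ℕ} (μ : Measure (Src nx ny nz)) :
    Matrix (Fin nx) (Fin nx) ℝ :=
  condCov μ (fun p => p.1) (fun p => (p.2.1, p.2.2))

/-- `ν` is the joint law of `((x, y, z), u)` where `(x, y, z)` has law `μ` and `u` is a random
vector with the Markov chain `u ↔ y ↔ (x, z)`, i.e. `u` and `(x, z)` are conditionally independent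
given `y`. -/
structure IsAdmissible {nx ny nz k : ℕ} (μ : Measure (Src nx ny nz))
    (ν : Measure (Src nx ny nz × EuclideanSpace ℝ (Fin k))) [IsFiniteMeasure ν] : Prop where
  marginal : ν.map (fun p => p.1) = μ
  markov : CondIndepFun
    (MeasurableSpace.comap (fun p : Src nx ny nz × EuclideanSpace ℝ (Fin k) => p.1.2.1)
      inferInstance)
    (Measurable.comap_le (by fun_prop))
    (fun p => p.2) (fun p => (p.1.1, p.1.2.2)) ν

/-- The rate `I(y; u | z)` of an admissible joint law. -/
noncomputable def rate {nx ny nz k : ℕ}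
    (ν : Measure (Src nx ny nz × EuclideanSpace ℝ (Fin k))) [IsFiniteMeasure ν] : EReal :=
  (condMutualInfo ν (fun p => p.1.2.1) (fun p => p.2) (fun p => p.1.2.2) : ENNReal)

/-- All values of `I(y; u | z)` for random vectors `u` with `Σ_{x|uz} ⪯ D` and
`u ↔ y ↔ (x, z)`. The minimum of this set is the information rate-distortion function at `D`. -/
def feasibleRates {nx ny nz : ℕ} (μ : Measure (Src nx ny nz)) (D : Matrix (Fin nx) (Fin nx) ℝ) :
    Set EReal :=
  {r | ∃ (k : ℕ) (ν : Measure (Src nx ny nz × EuclideanSpace ℝ (Fin k)))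
      (_ : IsProbabilityMeasure ν),
    IsAdmissible μ ν ∧
    (D - condCov ν (fun p => p.1.1) (fun p => (p.2, p.1.2.2))).PosSemidef ∧
    r = rate ν}

/-- The same set of rates, with the distortion constraint imposed almost surely on the conditional
covariance matrix of `x` given the values of `u` and `z`. -/
def feasibleRatesAE {nx ny nz : ℕ} (μ : Measure (Src nx ny nz)) (D : Matrix (Fin nx) (Fin nx) ℝ) :
    Set EReal :=
  {r | ∃ (k : ℕ) (ν : Measure (Src nx ny nz × EuclideanSpace ℝ (Fin k)))
      (_ : IsProbabilityMeasure ν),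
    IsAdmissible μ ν ∧
    (∀ᵐ p ∂ν, (D - condCovGiven ν (fun p => p.1.1) (fun p => (p.2, p.1.2.2)) p).PosSemidef) ∧
    r = rate ν}

end RemoteWynerZiv

/-!
Congruence by an invertible matrix `V` diagonalizes `D - Σ_{x|yz}` and `Σ_{x|z} - Σ_{x|yz}` at once,
with positive diagonals `t` and `s` (`exists_coordinates`), and the claimed rate becomes
`∑ i, log (s i / m i) / 2` with `m i = min (t i) (s i)`. In these coordinates a Gaussian source splits
(`exists_isSplitting`) as `V x = ξ (z) + w + r`. Here `w` is the part of `E[V x | y, z]` that `z` does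
not predict: it is a function of `(y, z)`, independent of `z`, with independent components
`w i ∼ N(0, s i)`. The residual `r` is independent of `(y, z)`, and by the Markov chain also of
`(y, z, u)` for every admissible `u` (`IsAdmissible.indepFun`).

Converse (`rate_lower_bound`): since `r` is independent of `(y, z, u)`, the distortion constraint
says in particular that `w i` has an estimator from `(u, z)` with mean squared error at most `t i`;
the constant estimator has error `s i`. So there is an estimator `g i (u, z)` with error at most
`m i`. The rate is a Kullback-Leibler divergence, and the Donsker-Varadhan inequality bounds it below
by the mean of any function whose exponential has integral at most one under the reference measure.
Under that measure `w` is independent of `(u, z)` (`lintegral_reference_of_indepFun`), hence the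
logarithm of the density of `∏ N(g i (u, z), m i)` with respect to `∏ N(0, s i)`, evaluated at `w`,
is allowed, and its mean is at least `∑ i, log (s i / m i) / 2` (`ofReal_le_condMutualInfo`). Only
second moments of `u` enter, so no assumption on the law of `u` is needed.

Attainment: the channel `u i = a i * C i y + n i` with standard Gaussian noise `n`, where `C i y` is the
`y`-part of `w i`, and the gain satisfies `1 + (a i)² * s i = s i / m i`. The error of the linear
estimator of `w` is independent of `(u, z)` and has covariance `diag m`, so the error covariance of
`V x`, conditional or not, is `diag m + V Σ_{x|yz} Vᵀ ⪯ V D Vᵀ` (`IsTestChannel.conj_condCov`). The rate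
follows from the explicit density of the joint law with respect to the reference measure
(`IsTestChannel.condMutualInfo_eq`). This channel also meets the almost sure constraint, which in
turn is the stronger one (`feasibleRatesAE_subset`); so both minima agree.
-/

open scoped ENNReal NNReal

namespace RemoteWynerZiv

/-! ### Relative entropy and exponential densities -/

/-- The Donsker-Varadhan lower bound, for test functions with `∫ exp f dQ ≤ 1`. -/
theorem ofReal_integral_le_klDiv {α : Type*} [MeasurableSpace α] {P Q : Measure α}
    [IsProbabilityMeasure P] [IsProbabilityMeasure Q] {f : α → ℝ} (hf : Measurable f)
    (hfi : Integrable f P) (hQ : ∫⁻ a, ENNReal.ofReal (Real.exp (f a)) ∂Q ≤ 1) :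
    ENNReal.ofReal (∫ a, f a ∂P) ≤ InformationTheory.klDiv P Q := by
  by_cases hac : P ≪ Q
  swap; · simp [hac]
  by_cases hint : Integrable (llr P Q) P
  swap; · simp [hint]
  rw [InformationTheory.klDiv_of_ac_of_integrable hac hint]
  apply ENNReal.ofReal_le_ofReal
  simp only [probReal_univ, add_sub_cancel_right]
  -- `exp (f - llr)` has `P`-integral at most `∫ exp f dQ ≤ 1`
  have hle : ∫⁻ a, ENNReal.ofReal (Real.exp (f a - llr P Q a)) ∂P ≤ 1 := by
    calc ∫⁻ a, ENNReal.ofReal (Real.exp (f a - llr P Q a)) ∂P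
        ≤ ∫⁻ a, (Q.rnDeriv P * fun a => ENNReal.ofReal (Real.exp (f a))) a ∂P := by
          refine lintegral_mono_ae ?_
          filter_upwards [exp_neg_llr hac] with a ha
          rw [sub_eq_add_neg, add_comm, Real.exp_add, ha, ENNReal.ofReal_mul ENNReal.toReal_nonneg,
            Pi.mul_apply]
          gcongr
          exact ENNReal.ofReal_toReal_le
      _ = ∫⁻ a, ENNReal.ofReal (Real.exp (f a)) ∂(P.withDensity (Q.rnDeriv P)) :=
          (lintegral_withDensity_eq_lintegral_mul _ (Measure.measurable_rnDeriv _ _)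
            (by fun_prop)).symm
      _ ≤ ∫⁻ a, ENNReal.ofReal (Real.exp (f a)) ∂Q :=
          lintegral_mono' (Measure.withDensity_rnDeriv_le _ _) le_rfl
      _ ≤ 1 := hQ
  have hei : Integrable (fun a => Real.exp (f a - llr P Q a)) P := by
    refine ⟨(hf.sub (measurable_llr P Q)).exp.aestronglyMeasurable, ?_⟩
    rw [hasFiniteIntegral_iff_ofReal (Filter.Eventually.of_forall fun a => (Real.exp_pos _).le)]
    exact hle.trans_lt ENNReal.one_lt_top
  have he1 : ∫ a, Real.exp (f a - llr P Q a) ∂P ≤ 1 := by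
    rw [integral_eq_lintegral_of_nonneg_ae
      (Filter.Eventually.of_forall fun a => (Real.exp_pos _).le) hei.1]
    exact ENNReal.toReal_le_of_le_ofReal zero_le_one (by simpa using hle)
  have h2 : ∫ a, (f a - llr P Q a + 1) ∂P ≤ ∫ a, Real.exp (f a - llr P Q a) ∂P :=
    integral_mono ((hfi.sub hint).add (integrable_const 1)) hei fun a => Real.add_one_le_exp _
  rw [integral_add (f := fun a => f a - llr P Q a) (hfi.sub hint) (integrable_const 1),
    integral_sub hfi hint] at h2
  simp at h2
  linarith

theorem klDiv_withDensity_exp {α : Type*} [MeasurableSpace α] {P Q : Measure α}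
    [IsProbabilityMeasure P] [IsProbabilityMeasure Q] {f : α → ℝ} (hf : Measurable f)
    (hfi : Integrable f P) (hPQ : P = Q.withDensity fun a => ENNReal.ofReal (Real.exp (f a))) :
    InformationTheory.klDiv P Q = ENNReal.ofReal (∫ a, f a ∂P) := by
  have hac : P ≪ Q := hPQ ▸ withDensity_absolutelyContinuous _ _
  have hllr : llr P Q =ᵐ[P] f := by
    have h1 : P.rnDeriv Q =ᵐ[Q] fun a => ENNReal.ofReal (Real.exp (f a)) := by
      conv_lhs => rw [hPQ]
      exact Measure.rnDeriv_withDensity Q (by fun_prop)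
    filter_upwards [hac.ae_le h1] with a ha
    rw [llr, ha, ENNReal.toReal_ofReal (Real.exp_pos _).le, Real.log_exp]
  rw [InformationTheory.klDiv_of_ac_of_integrable hac ((integrable_congr hllr).2 hfi),
    integral_congr_ae hllr]
  simp

/-! ### Densities of Gaussian product measures -/

/-- The logarithm of the density of `N(a, v)` with respect to `N(b, s)`, at `t`. -/
noncomputable def gaussLLR (a : ℝ) (v : ℝ≥0) (b : ℝ) (s : ℝ≥0) (t : ℝ) : ℝ :=
  Real.log (s / v) / 2 - (t - a) ^ 2 / (2 * v) + (t - b) ^ 2 / (2 * s)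

theorem gaussianReal_eq_withDensity {a b : ℝ} {v s : ℝ≥0} (hv : v ≠ 0) (hs : s ≠ 0) :
    gaussianReal a v
      = (gaussianReal b s).withDensity fun t => ENNReal.ofReal (Real.exp (gaussLLR a v b s t)) := by
  have hv' : (0 : ℝ) < v := by positivity
  have hs' : (0 : ℝ) < s := by positivity
  rw [gaussianReal_of_var_ne_zero a hv, gaussianReal_of_var_ne_zero b hs,
    ← withDensity_mul _ (measurable_gaussianPDF b s) (by unfold gaussLLR; fun_prop)]
  congr 1
  ext t
  rw [Pi.mul_apply, gaussianPDF, gaussianPDF, ← ENNReal.ofReal_mul (gaussianPDFReal_nonneg _ _ _)]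
  congr 1
  rw [gaussianPDFReal, gaussianPDFReal, mul_assoc _ (Real.exp _), ← Real.exp_add]
  have : Real.exp (-(t - b) ^ 2 / (2 * s) + gaussLLR a v b s t)
      = √(s / v) * Real.exp (-(t - a) ^ 2 / (2 * v)) := by
    rw [Real.sqrt_eq_rpow, Real.rpow_def_of_pos (by positivity), ← Real.exp_add]
    congr 1
    unfold gaussLLR
    ring
  rw [this, ← mul_assoc]
  congr 1
  have h2 : ∀ c : ℝ, √(2 * Real.pi * c) = √(2 * Real.pi) * √c := Real.sqrt_mul (by positivity)
  rw [Real.sqrt_div (by positivity), h2, h2]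
  field_simp

theorem pi_withDensity {ι : Type*} [Fintype ι] {Q : ι → Measure ℝ} [∀ i, IsProbabilityMeasure (Q i)]
    {f : ι → ℝ → ℝ≥0∞} (hf : ∀ i, Measurable (f i)) [∀ i, SigmaFinite ((Q i).withDensity (f i))] :
    Measure.pi (fun i => (Q i).withDensity (f i))
      = (Measure.pi Q).withDensity fun t => ∏ i, f i (t i) := by
  refine Measure.pi_eq fun s hs => ?_
  rw [withDensity_apply _ (MeasurableSet.univ_pi hs), ← lintegral_indicator (MeasurableSet.univ_pi hs)]
  have : (Set.univ.pi s).indicator (fun t : ι → ℝ => ∏ i, f i (t i))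
      = fun t => ∏ i, (s i).indicator (f i) (t i) := by
    ext t
    by_cases h : t ∈ Set.univ.pi s
    · rw [Set.indicator_of_mem h]
      exact Finset.prod_congr rfl fun i _ => (Set.indicator_of_mem (h i trivial) _).symm
    · rw [Set.indicator_of_notMem h]
      simp only [Set.mem_univ_pi, not_forall] at h
      obtain ⟨i, hi⟩ := h
      exact (Finset.prod_eq_zero (Finset.mem_univ i) (Set.indicator_of_notMem hi _)).symm
  have hind : iIndepFun (fun i (t : ι → ℝ) => (s i).indicator (f i) (t i)) (Measure.pi Q) :=
    iIndepFun_pi fun i => ((hf i).indicator (hs i)).aemeasurable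
  rw [this, lintegral_prod_eq_prod_lintegral_of_indepFun _ _ hind
    fun i => ((hf i).indicator (hs i)).comp (measurable_pi_apply i)]
  refine Finset.prod_congr rfl fun i _ => ?_
  rw [withDensity_apply _ (hs i), ← lintegral_indicator (hs i),
    ← (measurePreserving_eval Q i).lintegral_comp ((hf i).indicator (hs i))]

theorem pi_gaussianReal_eq_withDensity {ι : Type*} [Fintype ι] {a b : ι → ℝ} {v s : ι → ℝ≥0}
    (hv : ∀ i, v i ≠ 0) (hs : ∀ i, s i ≠ 0) :
    Measure.pi (fun i => gaussianReal (a i) (v i))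
      = (Measure.pi fun i => gaussianReal (b i) (s i)).withDensity
        fun t => ENNReal.ofReal (Real.exp (∑ i, gaussLLR (a i) (v i) (b i) (s i) (t i))) := by
  have h : ∀ i, gaussianReal (a i) (v i) = (gaussianReal (b i) (s i)).withDensity
      fun t => ENNReal.ofReal (Real.exp (gaussLLR (a i) (v i) (b i) (s i) t)) :=
    fun i => gaussianReal_eq_withDensity (hv i) (hs i)
  have : ∀ i, SigmaFinite ((gaussianReal (b i) (s i)).withDensity
      fun t => ENNReal.ofReal (Real.exp (gaussLLR (a i) (v i) (b i) (s i) t))) :=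
    fun i => h i ▸ inferInstance
  rw [funext h, pi_withDensity fun i => by unfold gaussLLR; fun_prop]
  congr 1
  ext t
  rw [Real.exp_sum, ENNReal.ofReal_prod_of_nonneg fun i _ => (Real.exp_pos _).le]

/-! ### Independence of three random variables -/

/-- A variable that is independent of two independent variables jointly can be grouped with either
of them. -/
theorem indepFun_prodMk_of_indepFun {Ω α β γ : Type*} [MeasurableSpace Ω] [MeasurableSpace α]
    [MeasurableSpace β] [MeasurableSpace γ] {P : Measure Ω} [IsProbabilityMeasure P] {X : Ω → α}
    {Y : Ω → β} {Z : Ω → γ} (hX : Measurable X) (hY : Measurable Y) (hZ : Measurable Z)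
    (h₁ : IndepFun X (fun ω => (Y ω, Z ω)) P) (h₂ : IndepFun Y Z P) :
    IndepFun (fun ω => (X ω, Y ω)) Z P := by
  have h₃ : IndepFun X Y P := h₁.comp measurable_id measurable_fst
  rw [indepFun_iff_map_prod_eq_prod_map_map (by fun_prop) (by fun_prop)] at h₁ h₂ h₃ ⊢
  have : (fun ω => ((X ω, Y ω), Z ω))
      = MeasurableEquiv.prodAssoc.symm ∘ fun ω => (X ω, (Y ω, Z ω)) := rfl
  rw [this, ← Measure.map_map (MeasurableEquiv.measurable _) (by fun_prop), h₁, h₂, h₃]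
  have := Measure.isProbabilityMeasure_map (μ := P) hX.aemeasurable
  have := Measure.isProbabilityMeasure_map (μ := P) hY.aemeasurable
  have := Measure.isProbabilityMeasure_map (μ := P) hZ.aemeasurable
  exact (measurePreserving_prodAssoc _ _ _).symm.map_eq

theorem indepFun_map_iff_comp {Ω Ω' α β : Type*} [MeasurableSpace Ω] [MeasurableSpace Ω']
    [MeasurableSpace α] [MeasurableSpace β] {P : Measure Ω} {g : Ω → Ω'} (hg : Measurable g)
    {X : Ω' → α} {Y : Ω' → β} (hX : Measurable X) (hY : Measurable Y) :
    IndepFun X Y (P.map g) ↔ IndepFun (X ∘ g) (Y ∘ g) P := by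
  simp only [indepFun_iff_measure_inter_preimage_eq_mul]
  refine forall₄_congr fun s t hs ht => ?_
  rw [Measure.map_apply hg ((hX hs).inter (hY ht)), Measure.map_apply hg (hX hs),
    Measure.map_apply hg (hY ht)]
  rfl

/-! ### Simultaneous diagonalization -/

theorem posDef_conj {n : ℕ} {S V : Matrix (Fin n) (Fin n) ℝ} (hS : S.PosDef) (hV : IsUnit V.det) :
    (V * S * Vᵀ).PosDef := by
  rw [← conjTranspose_eq_transpose_of_trivial]
  refine hS.mul_mul_conjTranspose_same ?_
  intro x y hxy
  have := congrArg (fun v => v ᵥ* V⁻¹) hxy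
  simpa [vecMul_vecMul, mul_nonsing_inv V hV] using this

/-- The eigenvalue decompositions behind `matrixMin` diagonalize both matrices by a congruence, and
express the determinant ratio through the diagonal entries. -/
theorem exists_simultaneous_diagonalization {n : ℕ} {S₁ S₂ : Matrix (Fin n) (Fin n) ℝ}
    (h₁ : S₁.PosDef) (h₂ : S₂.PosDef) :
    ∃ (V : Matrix (Fin n) (Fin n) ℝ) (lam lam' : Fin n → ℝ), IsUnit V.det ∧
      (∀ i, 0 < lam i) ∧ (∀ i, 0 < lam' i) ∧ V * S₁ * Vᵀ = diagonal lam ∧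
      V * S₂ * Vᵀ = diagonal lam' ∧
      S₂.det / (matrixMin S₁ S₂).det = ∏ i, lam' i / min (lam i) (lam' i) := by
  obtain ⟨V, lam, lam', ⟨U, W, R, gam, hU, hW, -, -, hS, hR, hG, hV, hl⟩, hM⟩ :=
    (isMatrixMin_iff h₁ h₂).2 rfl
  have a1 : U * Uᵀ = 1 := (mem_orthogonalGroup_iff (Fin n) ℝ).1 hU
  have a2 : Uᵀ * U = 1 := (mem_orthogonalGroup_iff' (Fin n) ℝ).1 hU
  have c1 : W * Wᵀ = 1 := (mem_orthogonalGroup_iff (Fin n) ℝ).1 hW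
  have hUu : IsUnit U.det := by
    rw [← isUnit_iff_isUnit_det]
    exact IsUnit.of_mul_eq_one _ a1
  have hpos : ∀ i, 0 < lam i := by
    have e : U * S₁ * Uᵀ = diagonal lam := by
      rw [hS]
      calc U * (Uᵀ * diagonal lam * U) * Uᵀ = (U * Uᵀ) * diagonal lam * (U * Uᵀ) := by
            simp only [mul_assoc]
        _ = _ := by rw [a1, one_mul, mul_one]
    exact posDef_diagonal_iff.1 (e ▸ posDef_conj h₁ hUu)
  set L := diagonal (fun i => √(lam i)) with hL
  have hLL : L * L = diagonal lam := by
    rw [hL, diagonal_mul_diagonal]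
    congr 1; ext i
    exact Real.mul_self_sqrt (hpos i).le
  have hLT : Lᵀ = L := by simp [hL]
  have hRT : Rᵀ = R := by rw [hR]; simp [transpose_mul, hLT, mul_assoc]
  have hRR : S₁ = R * R := by
    rw [hS, hR, ← hLL]
    calc Uᵀ * (L * L) * U = Uᵀ * L * 1 * L * U := by simp only [mul_assoc, mul_one]
      _ = _ := by rw [← a1]; simp only [mul_assoc]
  have hRu : IsUnit R.det := by
    have := h₁.det_pos
    rw [hRR, det_mul] at this
    exact isUnit_iff_ne_zero.2 fun h => by simp [h] at this
  have r1 : R * R⁻¹ = 1 := mul_nonsing_inv R hRu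
  have r2 : R⁻¹ * R = 1 := nonsing_inv_mul R hRu
  have hVT : Vᵀ = R⁻¹ * Wᵀ * L := by
    rw [hV, transpose_mul, transpose_mul, transpose_nonsing_inv, hRT, hLT, mul_assoc]
  have e1 : V * S₁ * Vᵀ = diagonal lam := by
    rw [hVT, hV, hRR]
    calc L * W * R⁻¹ * (R * R) * (R⁻¹ * Wᵀ * L)
        = L * W * (R⁻¹ * R) * (R * R⁻¹) * Wᵀ * L := by simp only [mul_assoc]
      _ = L * (W * Wᵀ) * L := by rw [r1, r2]; simp only [mul_assoc, mul_one]
      _ = _ := by rw [c1, mul_one, hLL]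
  have e2 : V * S₂ * Vᵀ = diagonal lam' := by
    rw [hVT, hV]
    calc L * W * R⁻¹ * S₂ * (R⁻¹ * Wᵀ * L)
        = L * W * (R⁻¹ * S₂ * R⁻¹) * Wᵀ * L := by simp only [mul_assoc]
      _ = L * (W * Wᵀ) * diagonal gam * (W * Wᵀ) * L := by rw [hG]; simp only [mul_assoc]
      _ = diagonal lam' := by
        rw [c1, mul_one, mul_one, hL, diagonal_mul_diagonal, diagonal_mul_diagonal, hl]
        congr 1; ext i
        rw [mul_right_comm, Real.mul_self_sqrt (hpos i).le]
  have hVu : IsUnit V.det := by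
    have h := congrArg det e1
    rw [det_mul, det_mul, det_diagonal] at h
    have h0 : ∏ i, lam i ≠ 0 := Finset.prod_ne_zero_iff.2 fun i _ => (hpos i).ne'
    exact isUnit_iff_ne_zero.2 fun h' => h0 (by rw [← h, h']; simp)
  have hpos' : ∀ i, 0 < lam' i := posDef_diagonal_iff.1 (e2 ▸ posDef_conj h₂ hVu)
  refine ⟨V, lam, lam', hVu, hpos, hpos', e1, e2, ?_⟩
  have d2 := congrArg det e2
  rw [det_mul, det_mul, det_diagonal, det_transpose] at d2
  rw [hM, det_mul, det_mul, det_diagonal, det_transpose, det_nonsing_inv, Ring.inverse_eq_inv',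
    Finset.prod_div_distrib, ← d2]
  have := hVu.ne_zero
  have : ∏ i, min (lam i) (lam' i) ≠ 0 :=
    Finset.prod_ne_zero_iff.2 fun i _ => (lt_min (hpos i) (hpos' i)).ne'
  field_simp

/-! ### Linear regression -/

/-- Best linear prediction of `X` from `Z`, also when the covariance of `Z` is singular: `L` is
obtained by projecting the centered `X` in `L²` onto the finite-dimensional space of centered
linear functionals of `Z`. -/
theorem exists_linear_regression {Ω E : Type*} [MeasurableSpace Ω] {P : Measure Ω}
    [IsProbabilityMeasure P] [NormedAddCommGroup E] [NormedSpace ℝ E] [FiniteDimensional ℝ E]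
    {X : Ω → ℝ} {Z : Ω → E} (hX : MemLp X 2 P) (hZ : MemLp Z 2 P) :
    ∃ L : E →L[ℝ] ℝ, ∀ M : E →L[ℝ] ℝ, cov[fun ω => X ω - L (Z ω), fun ω => M (Z ω); P] = 0 := by
  have hM : ∀ M : E →L[ℝ] ℝ, MemLp (fun ω => M (Z ω)) 2 P := fun M => M.comp_memLp' hZ
  have hM0 : ∀ M : E →L[ℝ] ℝ, MemLp (fun ω => M (Z ω) - ∫ ω, M (Z ω) ∂P) 2 P :=
    fun M => (hM M).sub (memLp_const _)
  have hX0 : MemLp (fun ω => X ω - ∫ ω, X ω ∂P) 2 P := hX.sub (memLp_const _)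
  have hi : ∀ M : E →L[ℝ] ℝ, Integrable (fun ω => M (Z ω)) P :=
    fun M => (hM M).integrable (by norm_num)
  let T : (E →L[ℝ] ℝ) →ₗ[ℝ] Lp ℝ 2 P :=
    { toFun := fun M => (hM0 M).toLp
      map_add' := fun M N => by
        rw [← MemLp.toLp_add, MemLp.toLp_eq_toLp_iff]
        refine Filter.Eventually.of_forall fun ω => ?_
        simp only [_root_.add_apply, Pi.add_apply]
        rw [integral_add (hi M) (hi N)]
        ring
      map_smul' := fun c M => by
        rw [← MemLp.toLp_const_smul, MemLp.toLp_eq_toLp_iff]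
        refine Filter.Eventually.of_forall fun ω => ?_
        simp only [_root_.smul_apply, Pi.smul_apply, RingHom.id_apply, smul_eq_mul]
        rw [integral_const_mul]
        ring }
  have : FiniteDimensional ℝ (E →L[ℝ] ℝ) := inferInstance
  obtain ⟨L, hL⟩ : ∃ L, T L = (LinearMap.range T).starProjection hX0.toLp :=
    (LinearMap.range T).starProjection_apply_mem _
  refine ⟨L, fun M => ?_⟩
  have horth : inner ℝ (hX0.toLp - T L) (T M) = 0 := by
    rw [hL]
    exact Submodule.starProjection_inner_eq_zero _ _ (LinearMap.mem_range_self T M)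
  rw [L2.inner_def] at horth
  rw [covariance, ← horth]
  refine integral_congr_ae ?_
  filter_upwards [Lp.coeFn_sub hX0.toLp (T L), hX0.coeFn_toLp, (hM0 L).coeFn_toLp,
    (hM0 M).coeFn_toLp] with ω h1 h2 h3 h4
  have h3' : (T L) ω = _ := h3
  have h4' : (T M) ω = _ := h4
  rw [h1, Pi.sub_apply, h2, h3', h4', integral_sub (hX.integrable (by norm_num)) (hi L)]
  simp only [RCLike.inner_apply, conj_trivial]
  ring

/-! ### Covariance of linear combinations of the reconstruction error -/

section condCov

variable {Ω β : Type} [MeasurableSpace Ω] [mβ : MeasurableSpace β] {n : ℕ} {P : Measure Ω}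
  {X : Ω → EuclideanSpace ℝ (Fin n)} {W : Ω → β}

theorem memLp_residual (hX : MemLp X 2 P) (i : Fin n) : MemLp (residual P X W i) 2 P := by
  have h : MemLp (fun ω => X ω i) 2 P := (EuclideanSpace.proj (𝕜 := ℝ) i).comp_memLp' hX
  exact h.sub (h.condExp (by norm_num))

theorem integrable_residual_mul (hX : MemLp X 2 P) (i j : Fin n) :
    Integrable (fun ω => residual P X W i ω * residual P X W j ω) P :=
  (memLp_residual hX i).integrable_mul (memLp_residual hX j)

variable [IsProbabilityMeasure P]

theorem condExp_eq_zero_of_indepFun (hW : Measurable W) {e : Ω → ℝ} (he : Measurable e)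
    (hind : IndepFun e W P) (he0 : ∫ ω, e ω ∂P = 0) : P[e | mβ.comap W] =ᵐ[P] 0 := by
  have := condExp_indep_eq he.comap_le hW.comap_le (f := e)
    (comap_measurable e).stronglyMeasurable hind
  filter_upwards [this] with ω h
  simp [h, he0]

/-- If a linear combination of the components of `X` is a function of `W` plus an error with vanishing
conditional mean, then this error is the combination of the residuals. -/
theorem sum_residual_ae_eq (hW : Measurable W) (hX : MemLp X 2 P) {a : Fin n → ℝ} {g : β → ℝ}
    {e : Ω → ℝ} (hg : Measurable g) (hgi : Integrable (fun ω => g (W ω)) P) (he : Integrable e P)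
    (hd : ∀ ω, ∑ k, a k * X ω k = g (W ω) + e ω) (hce : P[e | mβ.comap W] =ᵐ[P] 0) :
    (fun ω => ∑ k, a k * residual P X W k ω) =ᵐ[P] e := by
  have hXi : ∀ k, Integrable (fun ω => X ω k) P := fun k =>
    ((EuclideanSpace.proj (𝕜 := ℝ) k).comp_memLp' hX).integrable (by norm_num)
  have h1 : P[fun ω => ∑ k, a k * X ω k | mβ.comap W]
      =ᵐ[P] fun ω => ∑ k, a k * (P[fun ω' => X ω' k | mβ.comap W]) ω := by
    have e1 : (fun ω => ∑ k, a k * X ω k) = ∑ k, a k • fun ω => X ω k := by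
      ext ω; simp
    rw [e1]
    refine (condExp_finsetSum (fun k _ => (hXi k).smul (a k)) _).trans ?_
    have := fun k => condExp_smul (μ := P) (a k) (fun ω => X ω k) (mβ.comap W)
    filter_upwards [ae_all_iff.2 this] with ω h
    simp [h]
  have h2 : P[fun ω => ∑ k, a k * X ω k | mβ.comap W] =ᵐ[P] fun ω => g (W ω) := by
    have e2 : (fun ω => ∑ k, a k * X ω k) = (fun ω => g (W ω)) + e := funext hd
    rw [e2]
    refine (condExp_add hgi he _).trans ?_
    rw [condExp_of_stronglyMeasurable hW.comap_le (f := fun ω => g (W ω))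
      (hg.comp (comap_measurable W)).stronglyMeasurable hgi]
    filter_upwards [hce] with ω h
    simp [h]
  filter_upwards [h1, h2] with ω h h'
  have : ∑ k, a k * residual P X W k ω
      = ∑ k, a k * X ω k - ∑ k, a k * (P[fun ω' => X ω' k | mβ.comap W]) ω := by
    simp only [residual, mul_sub, Finset.sum_sub_distrib]
  rw [this, ← h, h', hd]
  ring

theorem conj_apply (V S : Matrix (Fin n) (Fin n) ℝ) (i j : Fin n) :
    (V * S * Vᵀ) i j = ∑ k, ∑ l, V i k * V j l * S k l := by
  simp only [mul_apply, transpose_apply, Finset.sum_mul]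
  rw [Finset.sum_comm]
  exact Finset.sum_congr rfl fun k _ => Finset.sum_congr rfl fun l _ => by ring

variable {V : Matrix (Fin n) (Fin n) ℝ} {g : Fin n → β → ℝ} {e : Fin n → Ω → ℝ}

theorem conj_condCov_apply (hW : Measurable W) (hX : MemLp X 2 P) (hg : ∀ i, Measurable (g i))
    (hgi : ∀ i, Integrable (fun ω => g i (W ω)) P) (he : ∀ i, Integrable (e i) P)
    (hd : ∀ ω i, ∑ k, V i k * X ω k = g i (W ω) + e i ω)
    (hce : ∀ i, P[e i | mβ.comap W] =ᵐ[P] 0) (i j : Fin n) :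
    (V * condCov P X W * Vᵀ) i j = ∫ ω, e i ω * e j ω ∂P := by
  have h := fun i => sum_residual_ae_eq hW hX (hg i) (hgi i) (he i) (fun ω => hd ω i) (hce i)
  rw [conj_apply]
  have : ∫ ω, e i ω * e j ω ∂P
      = ∫ ω, ∑ k, ∑ l, V i k * V j l * (residual P X W k ω * residual P X W l ω) ∂P := by
    refine integral_congr_ae ?_
    filter_upwards [h i, h j] with ω hi hj
    rw [← hi, ← hj, Finset.sum_mul_sum]
    exact Finset.sum_congr rfl fun k _ => Finset.sum_congr rfl fun l _ => by ring
  rw [this, integral_finsetSum _ fun k _ => integrable_finsetSum _ fun l _ =>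
    (integrable_residual_mul hX k l).const_mul _]
  refine Finset.sum_congr rfl fun k _ => ?_
  rw [integral_finsetSum _ fun l _ => (integrable_residual_mul hX k l).const_mul _]
  exact Finset.sum_congr rfl fun l _ => by rw [integral_const_mul]; rfl

theorem conj_condCovGiven_apply (hW : Measurable W) (hX : MemLp X 2 P)
    (hg : ∀ i, Measurable (g i))
    (hgi : ∀ i, Integrable (fun ω => g i (W ω)) P) (he : ∀ i, Integrable (e i) P)
    (hd : ∀ ω i, ∑ k, V i k * X ω k = g i (W ω) + e i ω)
    (hce : ∀ i, P[e i | mβ.comap W] =ᵐ[P] 0) (i j : Fin n) :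
    ∀ᵐ ω ∂P, (V * condCovGiven P X W ω * Vᵀ) i j
      = (P[fun ω => e i ω * e j ω | mβ.comap W]) ω := by
  have h := fun i => sum_residual_ae_eq hW hX (hg i) (hgi i) (he i) (fun ω => hd ω i) (hce i)
  have h1 : (fun ω => e i ω * e j ω) =ᵐ[P]
      ∑ k, ∑ l, (V i k * V j l) • fun ω => residual P X W k ω * residual P X W l ω := by
    filter_upwards [h i, h j] with ω hi hj
    rw [← hi, ← hj, Finset.sum_mul_sum]
    simp only [Finset.sum_apply, Pi.smul_apply, smul_eq_mul]
    exact Finset.sum_congr rfl fun k _ => Finset.sum_congr rfl fun l _ => by ring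
  have hint := fun k l => (integrable_residual_mul (W := W) hX k l).smul (V i k * V j l)
  have h2 : ∀ k, P[∑ l, (V i k * V j l) • fun ω => residual P X W k ω * residual P X W l ω
      | mβ.comap W] =ᵐ[P] fun ω => ∑ l, V i k * V j l * condCovGiven P X W ω k l := by
    intro k
    refine (condExp_finsetSum (fun l _ => hint k l) _).trans ?_
    have := fun l => condExp_smul (μ := P) (V i k * V j l)
      (fun ω => residual P X W k ω * residual P X W l ω) (mβ.comap W)
    filter_upwards [ae_all_iff.2 this] with ω hω
    simp [hω, condCovGiven]
  have h3 := (condExp_congr_ae (m := mβ.comap W) h1).trans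
    (condExp_finsetSum (fun k _ => integrable_finsetSum' _ fun l _ => hint k l) _)
  filter_upwards [h3, ae_all_iff.2 h2] with ω a b
  rw [conj_apply, a, Finset.sum_apply]
  exact Finset.sum_congr rfl fun k _ => (b k).symm

end condCov

/-! ### Splitting a Gaussian source into innovations -/

/-- The component of `y` along `C` that is not predicted by `z`: `C y - h z`. -/
def innov {nx ny nz : ℕ} (C : Fin nx → EuclideanSpace ℝ (Fin ny) →L[ℝ] ℝ)
    (h : Fin nx → EuclideanSpace ℝ (Fin nz) → ℝ) (i : Fin nx) (p : Src nx ny nz) : ℝ :=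
  C i p.2.1 - h i p.2.2

/-- The transformed source `V x` is `ξ (z) + w + r`, where `ξ (z) = E[V x | z]`, the innovation
`w = C y - h z` is independent of `z` with independent components of law `N(0, s i)`, and the
residual `r = V x - E[V x | y, z]` is independent of `(y, z)`. -/
structure IsSplitting {nx ny nz : ℕ} (μ : Measure (Src nx ny nz)) (V : Matrix (Fin nx) (Fin nx) ℝ)
    (s : Fin nx → ℝ≥0) (C : Fin nx → EuclideanSpace ℝ (Fin ny) →L[ℝ] ℝ)
    (h ξ : Fin nx → EuclideanSpace ℝ (Fin nz) → ℝ) (r : Fin nx → Src nx ny nz → ℝ) : Prop where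
  measurable_h : ∀ i, Measurable (h i)
  measurable_ξ : ∀ i, Measurable (ξ i)
  measurable_r : ∀ i, Measurable (r i)
  memLp_ξ : ∀ i, MemLp (fun p => ξ i p.2.2) 2 μ
  memLp_r : ∀ i, MemLp (r i) 2 μ
  eq_add : ∀ p i, ∑ k, V i k * p.1 k = ξ i p.2.2 + innov C h i p + r i p
  indep_r : IndepFun (fun p i => r i p) (fun p => p.2) μ
  integral_r : ∀ i, ∫ p, r i p ∂μ = 0
  indep_w : IndepFun (fun p i => innov C h i p) (fun p => p.2.2) μ
  law_w : μ.map (fun p i => innov C h i p) = Measure.pi fun i => gaussianReal 0 (s i)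
  cov_r : ∀ i j, (V * covXYZ μ * Vᵀ) i j = ∫ p, r i p * r j p ∂μ

/-- For linear functions of a Gaussian vector, vanishing covariances give independence. -/
theorem indepFun_of_covariance_eq_zero {ι E F : Type*} [Finite ι] [NormedAddCommGroup E]
    [NormedSpace ℝ E] [MeasurableSpace E] [BorelSpace E] [CompleteSpace E]
    [SecondCountableTopology E] [NormedAddCommGroup F] [NormedSpace ℝ F] [MeasurableSpace F]
    [BorelSpace F] [CompleteSpace F] [SecondCountableTopology F] {μ : Measure E} [IsGaussian μ]
    (f : ι → E →L[ℝ] ℝ) (G : E →L[ℝ] F)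
    (h : ∀ i (M : F →L[ℝ] ℝ), cov[fun p => f i p, fun p => M (G p); μ] = 0) :
    IndepFun (fun p i => f i p) G μ := by
  have := Fintype.ofFinite ι
  classical
  have hG : HasGaussianLaw (fun p => ((fun i => f i p), G p)) μ :=
    (IsGaussian.hasGaussianLaw_id (μ := μ)).map_fun ((ContinuousLinearMap.pi f).prod G)
  refine hG.indepFun_of_covariance_strongDual fun L M => ?_
  have hL : L ∘ (fun p i => f i p) = fun p => ∑ i, L (Pi.single i 1) * f i p := by
    ext p
    have : (fun i => f i p) = ∑ i, f i p • (Pi.single i 1 : ι → ℝ) := by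
      ext j; simp [Pi.single_apply]
    simp only [Function.comp]
    rw [this, map_sum]
    simp [mul_comm]
  have hi : MemLp (fun p : E => p) 2 μ := IsGaussian.memLp_two_id
  have hfi : ∀ i, MemLp (fun p => L (Pi.single i 1) * f i p) 2 μ := fun i =>
    MemLp.const_mul ((f i).comp_memLp' hi) _
  have hMG : MemLp (M ∘ G) 2 μ := (M.comp G).comp_memLp' hi
  rw [hL, covariance_fun_sum_left hfi hMG]
  refine Finset.sum_eq_zero fun i _ => ?_
  rw [covariance_const_mul_left]
  simp [Function.comp_def, h]

/-- A Gaussian source splits in any coordinates in which `Σ_{x|z} - Σ_{x|yz}`, the covariance of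
`E[x|y, z] - E[x|z]`, is diagonal. The residual comes from the regression of `V x` on `(y, z)`, and
the innovation from the regression of its `y`-part on `z`. -/
theorem exists_isSplitting {nx ny nz : ℕ} (μ : Measure (Src nx ny nz)) [IsGaussian μ]
    (V : Matrix (Fin nx) (Fin nx) ℝ) (s : Fin nx → ℝ≥0)
    (hV : V * (covXZ μ - covXYZ μ) * Vᵀ = diagonal fun i => (s i : ℝ)) :
    ∃ C h ξ r, IsSplitting μ V s C h ξ r := by
  have hi : MemLp (fun p : Src nx ny nz => p) 2 μ := IsGaussian.memLp_two_id
  let π₁ := ContinuousLinearMap.fst ℝ (EuclideanSpace ℝ (Fin nx))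
    (EuclideanSpace ℝ (Fin ny) × EuclideanSpace ℝ (Fin nz))
  let π₂ := ContinuousLinearMap.snd ℝ (EuclideanSpace ℝ (Fin nx))
    (EuclideanSpace ℝ (Fin ny) × EuclideanSpace ℝ (Fin nz))
  let π₃ := (ContinuousLinearMap.snd ℝ (EuclideanSpace ℝ (Fin ny))
    (EuclideanSpace ℝ (Fin nz))).comp π₂
  let ℓ : Fin nx → Src nx ny nz →L[ℝ] ℝ := fun i =>
    ∑ k, V i k • (EuclideanSpace.proj k).comp π₁
  have hℓ : ∀ i p, ℓ i p = ∑ k, V i k * p.1 k := fun i p => by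
    simp [ℓ, π₁]
  have hlin : ∀ f : Src nx ny nz →L[ℝ] ℝ, MemLp (fun p => f p) 2 μ := fun f => f.comp_memLp' hi
  have hx : MemLp (fun p : Src nx ny nz => p.1) 2 μ :=
    π₁.comp_memLp' hi
  have hyz : MemLp (fun p : Src nx ny nz => p.2) 2 μ :=
    π₂.comp_memLp' hi
  have hz : MemLp (fun p : Src nx ny nz => p.2.2) 2 μ :=
    π₃.comp_memLp' hi
  -- regress `V x` on `(y, z)`, then the coefficient of `y` on `z`
  choose L hL using fun i => exists_linear_regression (hlin (ℓ i)) hyz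
  let C : Fin nx → EuclideanSpace ℝ (Fin ny) →L[ℝ] ℝ := fun i =>
    (L i).comp (ContinuousLinearMap.inl ℝ _ _)
  let Cy : Fin nx → Src nx ny nz →L[ℝ] ℝ := fun i =>
    (C i).comp ((ContinuousLinearMap.fst ℝ _ _).comp π₂)
  choose K hK using fun i => exists_linear_regression (hlin (Cy i)) hz
  let r₀ : Fin nx → Src nx ny nz →L[ℝ] ℝ := fun i =>
    ℓ i - (L i).comp π₂
  let w₀ : Fin nx → Src nx ny nz →L[ℝ] ℝ := fun i =>
    Cy i - (K i).comp π₃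
  let h : Fin nx → EuclideanSpace ℝ (Fin nz) → ℝ := fun i z => K i z + ∫ p, w₀ i p ∂μ
  let ξ : Fin nx → EuclideanSpace ℝ (Fin nz) → ℝ := fun i z =>
    L i (0, z) + h i z + ∫ p, r₀ i p ∂μ
  let r : Fin nx → Src nx ny nz → ℝ := fun i p => r₀ i p - ∫ p, r₀ i p ∂μ
  have hw : ∀ i p, innov C h i p = w₀ i p - ∫ p, w₀ i p ∂μ := fun i p => by
    simp only [innov, h, w₀, Cy, _root_.sub_apply, ContinuousLinearMap.comp_apply, π₃, π₂,
      ContinuousLinearMap.coe_snd', ContinuousLinearMap.coe_fst']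
    ring
  have hLs : ∀ i (y : EuclideanSpace ℝ (Fin ny)) (z : EuclideanSpace ℝ (Fin nz)),
      L i (y, z) = C i y + L i (0, z) := fun i y z => by
    simp only [C, ContinuousLinearMap.comp_apply, ContinuousLinearMap.inl_apply]
    rw [← map_add]; simp
  have heq : ∀ p i, ∑ k, V i k * p.1 k = ξ i p.2.2 + innov C h i p + r i p := fun p i => by
    have := hLs i p.2.1 p.2.2
    simp only [← hℓ, innov, ξ, r, r₀, _root_.sub_apply, π₂,
      ContinuousLinearMap.comp_apply, ContinuousLinearMap.coe_snd']
    have e : L i p.2 = L i (p.2.1, p.2.2) := rfl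
    rw [e, this]
    ring
  have hrL : ∀ i, MemLp (r i) 2 μ := fun i => (hlin (r₀ i)).sub (memLp_const _)
  have hwL : ∀ i, MemLp (innov C h i) 2 μ := fun i => by
    rw [funext (hw i)]; exact (hlin (w₀ i)).sub (memLp_const _)
  have hr0 : ∀ i, ∫ p, r i p ∂μ = 0 := fun i => by
    simp only [r]
    rw [integral_sub ((hlin _).integrable (by norm_num)) (integrable_const _)]
    simp
  have hw0 : ∀ i, ∫ p, innov C h i p ∂μ = 0 := fun i => by
    simp only [hw]
    rw [integral_sub ((hlin _).integrable (by norm_num)) (integrable_const _)]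
    simp
  have hrm : ∀ i, Measurable (r i) := fun i => (r₀ i).measurable.sub_const _
  have hhm : ∀ i, Measurable (h i) := fun i => (K i).measurable.add_const _
  have hwm : ∀ i, Measurable (innov C h i) := fun i => by
    rw [funext (hw i)]; exact (w₀ i).measurable.sub_const _
  have hξc : ∀ i, Continuous (ξ i) := fun i => by simp only [ξ, h]; fun_prop
  have hξL : ∀ i, MemLp (fun p : Src nx ny nz => ξ i p.2.2) 2 μ := fun i => by
    refine MemLp.add (MemLp.add ?_ (MemLp.add ?_ (memLp_const _))) (memLp_const _)
    · exact ((L i).comp (ContinuousLinearMap.inr ℝ _ _)).comp_memLp' hz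
    · exact (K i).comp_memLp' hz
  have hrind : IndepFun (fun p i => r i p) (fun p : Src nx ny nz => p.2) μ := by
    have := indepFun_of_covariance_eq_zero (μ := μ) r₀ π₂ hL
    exact this.comp (φ := fun t i => t i - ∫ p, r₀ i p ∂μ) (by fun_prop) measurable_id
  have hwind : IndepFun (fun p i => innov C h i p) (fun p : Src nx ny nz => p.2.2) μ := by
    have := indepFun_of_covariance_eq_zero (μ := μ) w₀ π₃ hK
    have h2 := this.comp (φ := fun t i => t i - ∫ p, w₀ i p ∂μ) (by fun_prop) measurable_id
    simp only [hw]
    exact h2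
  have hcov_r : ∀ i j, (V * covXYZ μ * Vᵀ) i j = ∫ p, r i p * r j p ∂μ := by
    refine conj_condCov_apply (g := fun i q => ξ i q.2 + (C i q.1 - h i q.2)) (by fun_prop) hx
      (fun i => ?_) (fun i => ?_) (fun i => (hrL i).integrable (by norm_num))
      (fun p i => heq p i) (fun i => ?_)
    · exact ((hξc i).measurable.comp measurable_snd).add
        (((C i).measurable.comp measurable_fst).sub ((hhm i).comp measurable_snd))
    · exact ((hξL i).add (hwL i)).integrable (by norm_num)
    · exact condExp_eq_zero_of_indepFun (by fun_prop) (hrm i)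
        (hrind.comp (measurable_pi_apply i) measurable_id) (hr0 i)
  have hcov_z : ∀ i j, (V * covXZ μ * Vᵀ) i j
      = ∫ p, (innov C h i p + r i p) * (innov C h j p + r j p) ∂μ := by
    refine conj_condCov_apply (g := ξ) (e := fun i p => innov C h i p + r i p) (by fun_prop) hx
      (fun i => (hξc i).measurable) (fun i => (hξL i).integrable (by norm_num))
      (fun i => ((hwL i).add (hrL i)).integrable (by norm_num))
      (fun p i => by rw [heq, add_assoc]) (fun i => ?_)
    refine (condExp_add ((hwL i).integrable (by norm_num)) ((hrL i).integrable (by norm_num))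
      _).trans ?_
    have a1 := condExp_eq_zero_of_indepFun (W := fun p : Src nx ny nz => p.2.2) (by fun_prop)
      (hrm i) (hrind.comp (measurable_pi_apply i) measurable_snd) (hr0 i)
    have a2 := condExp_eq_zero_of_indepFun (W := fun p : Src nx ny nz => p.2.2) (by fun_prop)
      (hwm i) (hwind.comp (measurable_pi_apply i) measurable_id) (hw0 i)
    filter_upwards [a1, a2] with p h1 h2
    simp [h1, h2]
  have hrw : ∀ i j, ∫ p, r i p * innov C h j p ∂μ = 0 := fun i j => by
    have hind : IndepFun (r i) (innov C h j) μ :=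
      hrind.comp (measurable_pi_apply i) (ψ := fun q : EuclideanSpace ℝ (Fin ny) ×
          EuclideanSpace ℝ (Fin nz) => C j q.1 - h j q.2)
        (((C j).measurable.comp measurable_fst).sub ((hhm j).comp measurable_snd))
    have := hind.integral_mul_eq_mul_integral (hrm i).aestronglyMeasurable
      (hwm j).aestronglyMeasurable
    rw [hr0, zero_mul] at this
    exact this
  have hcov_w : ∀ i j, ∫ p, innov C h i p * innov C h j p ∂μ = diagonal (fun i => (s i : ℝ)) i j := by
    intro i j
    rw [← hV, mul_sub, sub_mul, Matrix.sub_apply, hcov_z, hcov_r]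
    have e : ∀ p, (innov C h i p + r i p) * (innov C h j p + r j p)
        = innov C h i p * innov C h j p + r j p * innov C h i p + r i p * innov C h j p
          + r i p * r j p := fun p => by ring
    simp only [e]
    have i1 : Integrable (fun p => innov C h i p * innov C h j p) μ := (hwL i).integrable_mul (hwL j)
    have i2 : Integrable (fun p => r j p * innov C h i p) μ := (hrL j).integrable_mul (hwL i)
    have i3 : Integrable (fun p => r i p * innov C h j p) μ := (hrL i).integrable_mul (hwL j)
    have i4 : Integrable (fun p => r i p * r j p) μ := (hrL i).integrable_mul (hrL j)
    rw [integral_add (f := fun p => innov C h i p * innov C h j p + r j p * innov C h i p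
        + r i p * innov C h j p) ((i1.add i2).add i3) i4,
      integral_add (f := fun p => innov C h i p * innov C h j p + r j p * innov C h i p)
        (i1.add i2) i3, integral_add i1 i2, hrw, hrw]
    ring
  have hcw : ∀ i j, cov[fun p => w₀ i p, fun p => w₀ j p; μ] = diagonal (fun i => (s i : ℝ)) i j := by
    intro i j
    rw [covariance, ← hcov_w]
    simp only [hw]
  have hG : HasGaussianLaw (fun p i => w₀ i p) μ :=
    (IsGaussian.hasGaussianLaw_id (μ := μ)).map_fun (ContinuousLinearMap.pi w₀)
  have hii : iIndepFun (fun i p => innov C h i p) μ := by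
    have := hG.iIndepFun_of_covariance_eq_zero fun i j hij => by
      rw [hcw, diagonal_apply_ne _ hij]
    have h2 := this.comp (fun i t => t - ∫ p, w₀ i p ∂μ) fun i => by fun_prop
    simp only [hw]
    exact h2
  have hlaw : ∀ i, μ.map (innov C h i) = gaussianReal 0 (s i) := fun i => by
    have h1 := (hG.eval i).map_eq_gaussianReal
    have h2 : innov C h i = (fun t => t - ∫ p, w₀ i p ∂μ) ∘ fun p => w₀ i p := funext (hw i)
    have h3 := (w₀ i).measurable
    rw [h2, ← Measure.map_map (f := fun p => w₀ i p)
      (g := fun t => t - ∫ p, w₀ i p ∂μ) (measurable_id.sub_const _) h3, h1, gaussianReal_map_sub_const,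
      sub_self, ← covariance_self h3.aemeasurable, hcw, diagonal_apply_eq, Real.toNNReal_coe]
  exact ⟨C, h, ξ, r, hhm, fun i => (hξc i).measurable, hrm, hξL, hrL, heq, hrind, hr0, hwind, by
    rw [(iIndepFun_iff_map_fun_eq_pi_map fun i => (hwm i).aemeasurable).1 hii, funext hlaw],
    hcov_r⟩

/-! ### Vectors of independent centered Gaussian components -/

section GaussianVector

/-- The vector with components `α i * X i + β i * N i`. -/
def comb {Ω ι : Type*} (α β : ι → ℝ) (X N : Ω → ι → ℝ) (ω : Ω) (i : ι) : ℝ :=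
  α i * X ω i + β i * N ω i

theorem measurable_comb {Ω ι : Type*} [MeasurableSpace Ω] {α β : ι → ℝ} {X N : Ω → ι → ℝ}
    (hX : Measurable X) (hN : Measurable N) : Measurable (comb α β X N) :=
  measurable_pi_lambda _ fun i => by unfold comb; fun_prop

variable {Ω ι : Type*} [MeasurableSpace Ω] [Fintype ι] {P : Measure Ω} {X : Ω → ι → ℝ}
  {v : ι → ℝ≥0}

theorem map_eval_of_map_eq_pi (hX : Measurable X)
    (hl : P.map X = Measure.pi fun i => gaussianReal 0 (v i)) (i : ι) :
    P.map (fun ω => X ω i) = gaussianReal 0 (v i) := by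
  have h1 := congrArg (Measure.map (Function.eval i)) hl
  rwa [Measure.map_map (measurable_pi_apply i) hX, (measurePreserving_eval _ i).map_eq] at h1

theorem memLp_of_map_eq_pi (hX : Measurable X)
    (hl : P.map X = Measure.pi fun i => gaussianReal 0 (v i)) (i : ι) :
    MemLp (fun ω => X ω i) 2 P := by
  have h1 : MemLp id 2 (P.map fun ω => X ω i) := by
    rw [map_eval_of_map_eq_pi hX hl]; exact memLp_id_gaussianReal' 2 (by norm_num)
  exact (memLp_map_measure_iff (by fun_prop) (by fun_prop)).1 h1

theorem integral_of_map_eq_pi (hX : Measurable X)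
    (hl : P.map X = Measure.pi fun i => gaussianReal 0 (v i)) (i : ι) : ∫ ω, X ω i ∂P = 0 := by
  have := integral_map (μ := P) (φ := fun ω => X ω i) (by fun_prop) (f := fun t : ℝ => t)
    (by fun_prop)
  rw [← this, map_eval_of_map_eq_pi hX hl, integral_id_gaussianReal]

theorem integral_sq_of_map_eq_pi (hX : Measurable X)
    (hl : P.map X = Measure.pi fun i => gaussianReal 0 (v i)) (i : ι) :
    ∫ ω, X ω i ^ 2 ∂P = v i := by
  have := integral_map (μ := P) (φ := fun ω => X ω i) (by fun_prop) (f := fun t : ℝ => t ^ 2)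
    (by fun_prop)
  rw [← this, map_eval_of_map_eq_pi hX hl]
  have h2 := variance_fun_id_gaussianReal (μ := 0) (v := v i)
  rw [variance_eq_integral (by fun_prop), integral_id_gaussianReal] at h2
  simpa using h2

theorem iIndepFun_of_map_eq_pi [IsProbabilityMeasure P] (hX : Measurable X)
    (hl : P.map X = Measure.pi fun i => gaussianReal 0 (v i)) :
    iIndepFun (fun i ω => X ω i) P := by
  rw [iIndepFun_iff_map_fun_eq_pi_map fun i => by fun_prop]
  simp only [map_eval_of_map_eq_pi hX hl]
  exact hl

theorem integral_mul_of_map_eq_pi [DecidableEq ι] [IsProbabilityMeasure P] (hX : Measurable X)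
    (hl : P.map X = Measure.pi fun i => gaussianReal 0 (v i)) (i j : ι) :
    ∫ ω, X ω i * X ω j ∂P = if i = j then (v i : ℝ) else 0 := by
  by_cases hij : i = j
  · subst hij
    rw [if_pos rfl, ← integral_sq_of_map_eq_pi hX hl]
    simp only [sq]
  · have h1 := ((iIndepFun_of_map_eq_pi hX hl).indepFun hij).integral_mul_eq_mul_integral
      (memLp_of_map_eq_pi hX hl i).1 (memLp_of_map_eq_pi hX hl j).1
    rw [integral_of_map_eq_pi hX hl, zero_mul] at h1
    rw [if_neg hij]
    exact h1

theorem hasGaussianLaw_of_map_eq_pi [IsProbabilityMeasure P] (hX : Measurable X)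
    (hl : P.map X = Measure.pi fun i => gaussianReal 0 (v i)) : HasGaussianLaw X P :=
  iIndepFun.hasGaussianLaw (fun i => ⟨by
    rw [map_eval_of_map_eq_pi hX hl]; infer_instance⟩) (iIndepFun_of_map_eq_pi hX hl)

variable {N : Ω → ι → ℝ} {v' : ι → ℝ≥0} {α β α' β' : ι → ℝ}

theorem memLp_comb (hX : Measurable X)
    (hl : P.map X = Measure.pi fun i => gaussianReal 0 (v i)) (hN : Measurable N)
    (hl' : P.map N = Measure.pi fun i => gaussianReal 0 (v' i)) (i : ι) :
    MemLp (fun ω => comb α β X N ω i) 2 P :=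
  ((memLp_of_map_eq_pi hX hl i).const_mul _).add ((memLp_of_map_eq_pi hN hl' i).const_mul _)

variable [IsProbabilityMeasure P]

theorem integral_comb (hX : Measurable X)
    (hl : P.map X = Measure.pi fun i => gaussianReal 0 (v i)) (hN : Measurable N)
    (hl' : P.map N = Measure.pi fun i => gaussianReal 0 (v' i)) (i : ι) :
    ∫ ω, comb α β X N ω i ∂P = 0 := by
  unfold comb
  rw [integral_add (((memLp_of_map_eq_pi hX hl i).integrable (by norm_num)).const_mul _)
    (((memLp_of_map_eq_pi hN hl' i).integrable (by norm_num)).const_mul _), integral_const_mul,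
    integral_const_mul, integral_of_map_eq_pi hX hl, integral_of_map_eq_pi hN hl']
  simp

theorem integral_comb_mul_comb [DecidableEq ι] (hX : Measurable X)
    (hl : P.map X = Measure.pi fun i => gaussianReal 0 (v i)) (hN : Measurable N)
    (hl' : P.map N = Measure.pi fun i => gaussianReal 0 (v' i)) (hind : IndepFun X N P) (i j : ι) :
    ∫ ω, comb α β X N ω i * comb α' β' X N ω j ∂P
      = if i = j then α i * α' i * v i + β i * β' i * v' i else 0 := by
  have hXL := memLp_of_map_eq_pi hX hl
  have hNL := memLp_of_map_eq_pi hN hl'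
  have hXN : ∀ i j, ∫ ω, X ω i * N ω j ∂P = 0 := fun i j => by
    have := (hind.comp (measurable_pi_apply i)
      (measurable_pi_apply j)).integral_mul_eq_mul_integral (hXL i).1 (hNL j).1
    have h0 : ∫ ω, ((fun x : ι → ℝ => x i) ∘ X) ω ∂P = 0 := integral_of_map_eq_pi hX hl i
    rw [h0, zero_mul] at this
    exact this
  have i1 : Integrable (fun ω => α i * α' j * (X ω i * X ω j)) P :=
    ((hXL i).integrable_mul (hXL j)).const_mul _
  have i2 : Integrable (fun ω => α i * β' j * (X ω i * N ω j)) P :=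
    ((hXL i).integrable_mul (hNL j)).const_mul _
  have i3 : Integrable (fun ω => α' j * β i * (X ω j * N ω i)) P :=
    ((hXL j).integrable_mul (hNL i)).const_mul _
  have i4 : Integrable (fun ω => β i * β' j * (N ω i * N ω j)) P :=
    ((hNL i).integrable_mul (hNL j)).const_mul _
  have e : ∀ ω, comb α β X N ω i * comb α' β' X N ω j
      = α i * α' j * (X ω i * X ω j) + α i * β' j * (X ω i * N ω j)
        + α' j * β i * (X ω j * N ω i) + β i * β' j * (N ω i * N ω j) := fun ω => by
    unfold comb; ring
  simp only [e]
  rw [integral_add (f := fun ω => α i * α' j * (X ω i * X ω j) + α i * β' j * (X ω i * N ω j)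
        + α' j * β i * (X ω j * N ω i)) ((i1.add i2).add i3) i4,
    integral_add (f := fun ω => α i * α' j * (X ω i * X ω j) + α i * β' j * (X ω i * N ω j))
      (i1.add i2) i3, integral_add i1 i2]
  simp only [integral_const_mul, hXN, integral_mul_of_map_eq_pi hX hl,
    integral_mul_of_map_eq_pi hN hl']
  by_cases hij : i = j
  · subst hij; simp
  · simp [hij]

theorem hasGaussianLaw_comb_prodMk (hX : Measurable X)
    (hl : P.map X = Measure.pi fun i => gaussianReal 0 (v i)) (hN : Measurable N)
    (hl' : P.map N = Measure.pi fun i => gaussianReal 0 (v' i)) (hind : IndepFun X N P) :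
    HasGaussianLaw (fun ω => (comb α β X N ω, comb α' β' X N ω)) P := by
  have hG := hind.hasGaussianLaw (hasGaussianLaw_of_map_eq_pi hX hl)
    (hasGaussianLaw_of_map_eq_pi hN hl')
  let L : (ι → ℝ) → (ι → ℝ) → ((ι → ℝ) × (ι → ℝ) →L[ℝ] (ι → ℝ)) := fun a b =>
    ContinuousLinearMap.pi fun i =>
      a i • (ContinuousLinearMap.proj i).comp (ContinuousLinearMap.fst ℝ (ι → ℝ) (ι → ℝ))
      + b i • (ContinuousLinearMap.proj i).comp (ContinuousLinearMap.snd ℝ (ι → ℝ) (ι → ℝ))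
  exact hG.map_fun ((L α β).prod (L α' β'))

/-- Two combinations of independent Gaussian vectors are independent if they are uncorrelated in each
component. -/
theorem indepFun_comb (hX : Measurable X)
    (hl : P.map X = Measure.pi fun i => gaussianReal 0 (v i)) (hN : Measurable N)
    (hl' : P.map N = Measure.pi fun i => gaussianReal 0 (v' i)) (hind : IndepFun X N P)
    (h0 : ∀ i, α i * α' i * v i + β i * β' i * v' i = 0) :
    IndepFun (comb α β X N) (comb α' β' X N) P := by
  classical
  refine HasGaussianLaw.indepFun_of_covariance_eval (X := fun i ω => comb α β X N ω i)
    (Y := fun i ω => comb α' β' X N ω i) (hasGaussianLaw_comb_prodMk hX hl hN hl' hind)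
    fun i j => ?_
  rw [covariance_eq_sub (memLp_comb hX hl hN hl' i) (memLp_comb hX hl hN hl' j),
    integral_comb hX hl hN hl' i, zero_mul, sub_zero]
  have := integral_comb_mul_comb (α := α) (β := β) (α' := α') (β' := β') hX hl hN hl' hind i j
  rw [h0, ite_self] at this
  exact this

theorem map_comb (hX : Measurable X)
    (hl : P.map X = Measure.pi fun i => gaussianReal 0 (v i)) (hN : Measurable N)
    (hl' : P.map N = Measure.pi fun i => gaussianReal 0 (v' i)) (hind : IndepFun X N P)
    {τ : ι → ℝ≥0} (hτ : ∀ i, α i ^ 2 * v i + β i ^ 2 * v' i = τ i) :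
    P.map (comb α β X N) = Measure.pi fun i => gaussianReal 0 (τ i) := by
  classical
  have hG : HasGaussianLaw (fun ω i => comb α β X N ω i) P :=
    (hasGaussianLaw_comb_prodMk (α' := α) (β' := β) hX hl hN hl' hind).fst
  have hcov : ∀ i j, cov[fun ω => comb α β X N ω i, fun ω => comb α β X N ω j; P]
      = if i = j then (τ i : ℝ) else 0 := fun i j => by
    rw [covariance_eq_sub (memLp_comb hX hl hN hl' i) (memLp_comb hX hl hN hl' j),
      integral_comb hX hl hN hl' i, zero_mul, sub_zero, ← hτ]
    have := integral_comb_mul_comb (α := α) (β := β) (α' := α) (β' := β) hX hl hN hl' hind i j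
    simp only [sq]
    exact this
  have hii : iIndepFun (fun i ω => comb α β X N ω i) P :=
    hG.iIndepFun_of_covariance_eq_zero fun i j hij => by rw [hcov, if_neg hij]
  have hm := measurable_comb (α := α) (β := β) hX hN
  have h1 := (iIndepFun_iff_map_fun_eq_pi_map
    fun i => ((measurable_pi_apply i).comp hm).aemeasurable).1 hii
  have h2 : ∀ i, P.map (fun ω => comb α β X N ω i) = gaussianReal 0 (τ i) := fun i => by
    have hmi : AEMeasurable (fun ω => comb α β X N ω i) P :=
      ((measurable_pi_apply i).comp hm).aemeasurable
    rw [(hG.eval i).map_eq_gaussianReal, integral_comb hX hl hN hl' i, ← covariance_self hmi, hcov,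
      if_pos rfl, Real.toNNReal_coe]
  exact h1.trans (by simp only [Function.comp_def, h2])

end GaussianVector

/-! ### Moments of the innovations -/

namespace IsSplitting

variable {nx ny nz : ℕ} {μ : Measure (Src nx ny nz)} {V : Matrix (Fin nx) (Fin nx) ℝ}
  {s : Fin nx → ℝ≥0} {C : Fin nx → EuclideanSpace ℝ (Fin ny) →L[ℝ] ℝ}
  {h ξ : Fin nx → EuclideanSpace ℝ (Fin nz) → ℝ} {r : Fin nx → Src nx ny nz → ℝ}

theorem measurable_innov (H : IsSplitting μ V s C h ξ r) (i : Fin nx) :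
    Measurable (innov C h i) :=
  ((C i).measurable.comp (by fun_prop)).sub ((H.measurable_h i).comp (by fun_prop))

theorem memLp_innov (H : IsSplitting μ V s C h ξ r) (i : Fin nx) : MemLp (innov C h i) 2 μ :=
  memLp_of_map_eq_pi (measurable_pi_lambda _ H.measurable_innov) H.law_w i

theorem integral_innov_sq (H : IsSplitting μ V s C h ξ r) (i : Fin nx) :
    ∫ p, innov C h i p ^ 2 ∂μ = s i :=
  integral_sq_of_map_eq_pi (measurable_pi_lambda _ H.measurable_innov) H.law_w i

end IsSplitting

/-! ### Consequences of the Markov chain -/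

section Markov

variable {nx ny nz k : ℕ} {μ : Measure (Src nx ny nz)}
  {ν : Measure (Src nx ny nz × EuclideanSpace ℝ (Fin k))} [IsProbabilityMeasure ν]

/-- Disintegration of an admissible law along the Markov chain: `u` is drawn given `y` alone. -/
theorem IsAdmissible.lintegral_eq (H : IsAdmissible μ ν)
    {F : Src nx ny nz × EuclideanSpace ℝ (Fin k) → ℝ≥0∞} (hF : Measurable F) :
    ∫⁻ q, F q ∂ν
      = ∫⁻ p, ∫⁻ u, F (p, u) ∂(condDistrib (fun q => q.2) (fun q => q.1.2.1) ν p.2.1) ∂μ := by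
  set κ := condDistrib (fun q : Src nx ny nz × EuclideanSpace ℝ (Fin k) => q.2)
    (fun q => q.1.2.1) ν with hκ
  have h1 := (condIndepFun_iff_condDistrib_prod_ae_eq_prodMkRight
    (f := fun q : Src nx ny nz × EuclideanSpace ℝ (Fin k) => q.2)
    (g := fun q => (q.1.1, q.1.2.2)) (k := fun q => q.1.2.1) (μ := ν) (by fun_prop) (by fun_prop)
    (by fun_prop)).1 H.markov.symm
  rw [condDistrib_ae_eq_iff_measure_eq_compProd _ (by fun_prop), ← hκ] at h1
  let φ : (EuclideanSpace ℝ (Fin ny) × (EuclideanSpace ℝ (Fin nx) × EuclideanSpace ℝ (Fin nz)))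
      × EuclideanSpace ℝ (Fin k) → Src nx ny nz × EuclideanSpace ℝ (Fin k) :=
    fun a => ((a.1.2.1, (a.1.1, a.1.2.2)), a.2)
  have hφ : Measurable φ := by fun_prop
  have hFφ : Measurable fun a => F (φ a) := hF.comp hφ
  have h2 := lintegral_map (μ := ν) (f := fun a => F (φ a))
    (g := fun q => ((q.1.2.1, (q.1.1, q.1.2.2)), q.2)) hFφ (by fun_prop)
  rw [h1, Measure.lintegral_compProd hFφ, lintegral_map ?_ (by fun_prop)] at h2
  · rw [← H.marginal, lintegral_map ?_ measurable_fst]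
    · exact h2.symm
    · exact (hF.comp (f := fun a : Src nx ny nz × EuclideanSpace ℝ (Fin k) => a)
        measurable_id).lintegral_kernel_prod_right' (κ := κ.comap (fun p : Src nx ny nz => p.2.1)
          (by fun_prop))
  · exact hFφ.lintegral_kernel_prod_right' (κ := κ.prodMkRight _)

/-- What is independent of `(y, z)` stays independent when `u` is adjoined. -/
theorem IsAdmissible.indepFun {α : Type*} [MeasurableSpace α] (H : IsAdmissible μ ν)
    {f : Src nx ny nz → α} (hf : Measurable f) (hind : IndepFun f (fun p => p.2) μ) :
    IndepFun (fun q : Src nx ny nz × EuclideanSpace ℝ (Fin k) => f q.1)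
      (fun q => (q.1.2, q.2)) ν := by
  set κ := condDistrib (fun q : Src nx ny nz × EuclideanSpace ℝ (Fin k) => q.2)
    (fun q => q.1.2.1) ν with hκ
  have hμ : IsProbabilityMeasure μ := by
    rw [← H.marginal]; exact Measure.isProbabilityMeasure_map (by fun_prop)
  rw [indepFun_iff_measure_inter_preimage_eq_mul]
  intro A B hA hB
  let φ : EuclideanSpace ℝ (Fin ny) × EuclideanSpace ℝ (Fin nz) → ℝ≥0∞ := fun b =>
    ∫⁻ u, B.indicator (fun _ => 1) (b, u) ∂κ b.1
  have hφ : Measurable φ :=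
    (measurable_const.indicator hB).lintegral_kernel_prod_right' (κ := κ.comap Prod.fst measurable_fst)
  have key : ∀ S : Set α, MeasurableSet S →
      ν ((fun q => f q.1) ⁻¹' S ∩ (fun q => (q.1.2, q.2)) ⁻¹' B)
        = μ (f ⁻¹' S) * ∫⁻ p, φ p.2 ∂μ := by
    intro S hS
    have hm1 : Measurable (S.indicator (fun _ => (1 : ℝ≥0∞))) := measurable_const.indicator hS
    have hm2 : Measurable (B.indicator (fun _ => (1 : ℝ≥0∞))) := measurable_const.indicator hB
    have hf1 : Measurable fun q : Src nx ny nz × EuclideanSpace ℝ (Fin k) => f q.1 := by fun_prop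
    have hq : Measurable fun q : Src nx ny nz × EuclideanSpace ℝ (Fin k) => (q.1.2, q.2) := by
      fun_prop
    have hF : Measurable fun q : Src nx ny nz × EuclideanSpace ℝ (Fin k) =>
        S.indicator (fun _ => (1 : ℝ≥0∞)) (f q.1) * B.indicator (fun _ => 1) (q.1.2, q.2) :=
      (hm1.comp hf1).mul (hm2.comp hq)
    have e1 : ν ((fun q => f q.1) ⁻¹' S ∩ (fun q => (q.1.2, q.2)) ⁻¹' B)
        = ∫⁻ q, S.indicator (fun _ => 1) (f q.1) * B.indicator (fun _ => 1) (q.1.2, q.2) ∂ν := by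
      rw [← lintegral_indicator_one ((hf1 hS).inter (hq hB))]
      refine lintegral_congr fun q => ?_
      by_cases h1 : f q.1 ∈ S <;> by_cases h2 : (q.1.2, q.2) ∈ B <;> simp [h1, h2]
    have e2 : μ (f ⁻¹' S) = ∫⁻ p, S.indicator (fun _ => 1) (f p) ∂μ := by
      rw [← lintegral_indicator_one (hf hS)]
      rfl
    rw [e1, H.lintegral_eq hF, e2]
    refine Eq.trans (lintegral_congr fun p => ?_)
      (lintegral_mul_eq_lintegral_mul_lintegral_of_indepFun (hm1.comp hf)
        (hφ.comp measurable_snd) (hind.comp hm1 hφ))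
    exact lintegral_const_mul (S.indicator (fun _ => (1 : ℝ≥0∞)) (f p))
      (hm2.comp (f := fun u : EuclideanSpace ℝ (Fin k) => (p.2, u)) (by fun_prop))
  have k1 := key Set.univ MeasurableSet.univ
  simp only [Set.preimage_univ, Set.univ_inter, measure_univ, one_mul] at k1
  rw [key A hA, k1, ← H.marginal, Measure.map_apply measurable_fst (hf hA)]
  rfl

end Markov

/-! ### The reference measure of the conditional mutual information -/

section Reference

variable {Ω α β γ δ : Type} [MeasurableSpace Ω] [MeasurableSpace α] [StandardBorelSpace α]
  [Nonempty α] [MeasurableSpace β] [StandardBorelSpace β] [Nonempty β] [MeasurableSpace γ]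
  [MeasurableSpace δ] {P : Measure Ω} [IsProbabilityMeasure P] {Y : Ω → α} {U : Ω → β} {Z : Ω → γ}

/-- If `w (Y, Z)` is independent of `Z`, then under the reference measure of the conditional mutual
information it is independent of `(Z, U)`, with unchanged marginal laws. -/
theorem lintegral_reference_of_indepFun (hY : Measurable Y) (hU : Measurable U) (hZ : Measurable Z)
    {w : α × γ → δ} (hw : Measurable w) (hind : IndepFun (fun ω => w (Y ω, Z ω)) Z P)
    {F : δ × γ × β → ℝ≥0∞} (hF : Measurable F) :
    ∫⁻ a, F (w (a.2.1, a.1), a.1, a.2.2)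
        ∂(P.map Z ⊗ₘ (condDistrib Y Z P ×ₖ condDistrib U Z P))
      = ∫⁻ b, ∫⁻ t, F (t, b.1, b.2) ∂(P.map fun ω => w (Y ω, Z ω))
        ∂(P.map fun ω => (Z ω, U ω)) := by
  have hwm : Measurable fun ω => w (Y ω, Z ω) := by fun_prop
  have : IsProbabilityMeasure (P.map fun ω => w (Y ω, Z ω)) :=
    Measure.isProbabilityMeasure_map hwm.aemeasurable
  have : IsProbabilityMeasure (P.map Z) := Measure.isProbabilityMeasure_map hZ.aemeasurable
  -- integrate out `u` first
  let G : δ × γ → ℝ≥0∞ := fun b => ∫⁻ u, F (b.1, b.2, u) ∂condDistrib U Z P b.2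
  have hG : Measurable G :=
    (hF.comp (by fun_prop : Measurable fun a : (δ × γ) × β => (a.1.1, a.1.2, a.2))
      ).lintegral_kernel_prod_right' (κ := (condDistrib U Z P).comap Prod.snd measurable_snd)
  have hm : Measurable fun a : γ × α × β => F (w (a.2.1, a.1), a.1, a.2.2) := by fun_prop
  rw [Measure.lintegral_compProd hm]
  have e1 : ∀ z, ∫⁻ b, F (w (b.1, z), z, b.2) ∂(condDistrib Y Z P ×ₖ condDistrib U Z P) z
      = ∫⁻ y, G (w (y, z), z) ∂condDistrib Y Z P z := by
    intro z
    rw [Kernel.prod_apply, lintegral_prod _ (by fun_prop)]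
  simp only [e1]
  have e2 : ∫⁻ z, ∫⁻ y, G (w (y, z), z) ∂condDistrib Y Z P z ∂P.map Z
      = ∫⁻ ω, G (w (Y ω, Z ω), Z ω) ∂P := by
    rw [← Measure.lintegral_compProd (f := fun a : γ × α => G (w (a.2, a.1), a.1)) (by fun_prop),
      compProd_map_condDistrib hY.aemeasurable, lintegral_map (by fun_prop) (by fun_prop)]
  rw [e2]
  have e3 := (indepFun_iff_map_prod_eq_prod_map_map hwm.aemeasurable hZ.aemeasurable).1 hind
  rw [← lintegral_map (f := G) (g := fun ω => (w (Y ω, Z ω), Z ω)) hG (by fun_prop), e3,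
    lintegral_prod_symm' _ hG, ← compProd_map_condDistrib hU.aemeasurable,
    Measure.lintegral_compProd ?_]
  · refine lintegral_congr fun z => ?_
    exact lintegral_lintegral_swap (μ := P.map fun ω => w (Y ω, Z ω)) (ν := condDistrib U Z P z)
      (f := fun t u => F (t, z, u)) (by fun_prop)
  · exact Measurable.lintegral_prod_right' (f := fun a : (γ × β) × δ => F (a.2, a.1.1, a.1.2))
      (by fun_prop)

end Reference

/-! ### The lower bound on the rate -/

section LowerBound

variable {nx ny nz k : ℕ} {μ : Measure (Src nx ny nz)} {V : Matrix (Fin nx) (Fin nx) ℝ}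
  {s : Fin nx → ℝ≥0} {C : Fin nx → EuclideanSpace ℝ (Fin ny) →L[ℝ] ℝ}
  {h ξ : Fin nx → EuclideanSpace ℝ (Fin nz) → ℝ} {r : Fin nx → Src nx ny nz → ℝ}
  {ν : Measure (Src nx ny nz × EuclideanSpace ℝ (Fin k))} [IsProbabilityMeasure ν]

theorem IsAdmissible.measurePreserving (hν : IsAdmissible μ ν) :
    MeasurePreserving (fun q : Src nx ny nz × EuclideanSpace ℝ (Fin k) => q.1) ν μ :=
  ⟨measurable_fst, hν.marginal⟩

theorem IsAdmissible.integral_fst (hν : IsAdmissible μ ν) {f : Src nx ny nz → ℝ}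
    (hf : Measurable f) : ∫ q, f q.1 ∂ν = ∫ p, f p ∂μ := by
  rw [← hν.marginal, integral_map (by fun_prop) hf.aestronglyMeasurable]

theorem conj_diag_le {n : ℕ} {V D S T : Matrix (Fin n) (Fin n) ℝ} {t : Fin n → ℝ}
    (hD : V * (D - T) * Vᵀ = diagonal t) (hS : (D - S).PosSemidef) (i : Fin n) :
    (V * S * Vᵀ) i i ≤ t i + (V * T * Vᵀ) i i := by
  have h1 := (hS.mul_mul_conjTranspose_same V).diag_nonneg (i := i)
  rw [conjTranspose_eq_transpose_of_trivial, mul_sub, sub_mul, Matrix.sub_apply] at h1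
  have h2 := congrFun (congrFun hD i) i
  rw [mul_sub, sub_mul, Matrix.sub_apply, diagonal_apply_eq] at h2
  linarith

/-- The squared error of the conditional mean `E[w i | u, z]` is bounded by the distortion
constraint, because the residual `r` is independent of `(y, z, u)`. -/
theorem integral_sq_innov_sub_condExp_le (H : IsSplitting μ V s C h ξ r)
    (hμ : MemLp (fun p : Src nx ny nz => p.1) 2 μ) (hν : IsAdmissible μ ν)
    {D : Matrix (Fin nx) (Fin nx) ℝ} {t : Fin nx → ℝ}
    (hD : V * (D - covXYZ μ) * Vᵀ = diagonal t)
    (hdist : (D - condCov ν (fun p => p.1.1) (fun p => (p.2, p.1.2.2))).PosSemidef) (i : Fin nx) :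
    ∫ q, (innov C h i q.1 - (ν[fun q => innov C h i q.1 | MeasurableSpace.comap
      (fun q : Src nx ny nz × EuclideanSpace ℝ (Fin k) => (q.2, q.1.2.2)) inferInstance]) q) ^ 2 ∂ν
      ≤ t i := by
  set W : Src nx ny nz × EuclideanSpace ℝ (Fin k) → _ := fun q => (q.2, q.1.2.2) with hW
  have hWm : Measurable W := by fun_prop
  have hmp := hν.measurePreserving
  set ŵ := fun i => ν[fun q => innov C h i q.1 | MeasurableSpace.comap W inferInstance] with hŵ
  have hwL : ∀ i, MemLp (fun q => innov C h i q.1) 2 ν := fun i =>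
    (H.memLp_innov i).comp_measurePreserving hmp
  have hrL : ∀ i, MemLp (fun q => r i q.1) 2 ν := fun i =>
    (H.memLp_r i).comp_measurePreserving hmp
  have hξL : ∀ i, MemLp (fun q => ξ i q.1.2.2) 2 ν := fun i =>
    (H.memLp_ξ i).comp_measurePreserving hmp
  have hŵL : ∀ i, MemLp (ŵ i) 2 ν := fun i => (hwL i).condExp (by norm_num)
  have hqL : ∀ i, MemLp (fun q => innov C h i q.1 - ŵ i q) 2 ν := fun i => (hwL i).sub (hŵL i)
  have hr0 : ∀ i, ∫ q, r i q.1 ∂ν = 0 := fun i => by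
    rw [hν.integral_fst (H.measurable_r i), H.integral_r]
  choose g hgm hg using fun i => (stronglyMeasurable_condExp (μ := ν)
    (f := fun q => innov C h i q.1) (m := MeasurableSpace.comap W inferInstance)
    ).measurable.exists_eq_measurable_comp
  have hgW : ∀ i q, ŵ i q = g i (W q) := fun i q => congrFun (hg i) q
  have hrm : Measurable fun p i => r i p := measurable_pi_lambda _ H.measurable_r
  have hind : ∀ i, IndepFun (fun q : Src nx ny nz × EuclideanSpace ℝ (Fin k) => r i q.1)
      (fun q => (q.1.2, q.2)) ν := fun i =>
    (hν.indepFun hrm H.indep_r).comp (measurable_pi_apply i) measurable_id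
  have hcov := conj_condCov_apply (P := ν) (V := V) (X := fun q => q.1.1) (W := W)
    (g := fun i b => ξ i b.2 + g i b) (e := fun i q => (innov C h i q.1 - ŵ i q) + r i q.1) hWm
    (hμ.comp_measurePreserving hmp)
    (fun i => ((H.measurable_ξ i).comp measurable_snd).add (hgm i))
    (fun i => by
      simp only [← hgW]
      exact ((hξL i).add (hŵL i)).integrable (by norm_num))
    (fun i => ((hqL i).add (hrL i)).integrable (by norm_num))
    (fun q i => by rw [H.eq_add q.1 i, ← hgW]; simp only [hW]; ring)
    (fun i => by
      have hrW : IndepFun (fun q : Src nx ny nz × EuclideanSpace ℝ (Fin k) => r i q.1) W ν :=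
        (hind i).comp (φ := id) (ψ := fun a : (EuclideanSpace ℝ (Fin ny) ×
          EuclideanSpace ℝ (Fin nz)) × EuclideanSpace ℝ (Fin k) => (a.2, a.1.2))
          measurable_id (by fun_prop)
      have a1 := condExp_eq_zero_of_indepFun hWm ((H.measurable_r i).comp measurable_fst) hrW
        (hr0 i)
      have a2 := condExp_sub (μ := ν) (m := MeasurableSpace.comap W inferInstance)
        ((hwL i).integrable (by norm_num)) ((hŵL i).integrable (by norm_num))
      have a3 := condExp_add (μ := ν) (m := MeasurableSpace.comap W inferInstance)
        ((hqL i).integrable (by norm_num)) ((hrL i).integrable (by norm_num))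
      have a4 : ν[ŵ i | MeasurableSpace.comap W inferInstance] = ŵ i :=
        condExp_of_stronglyMeasurable hWm.comap_le stronglyMeasurable_condExp
          ((hŵL i).integrable (by norm_num))
      refine a3.trans ?_
      filter_upwards [a1, a2] with q h1 h2
      have h1' : (ν[fun q => r i q.1 | MeasurableSpace.comap W inferInstance]) q = 0 := h1
      have h2' : (ν[fun q => innov C h i q.1 - ŵ i q | MeasurableSpace.comap W inferInstance]) q
        = ŵ i q - (ν[ŵ i | MeasurableSpace.comap W inferInstance]) q := h2
      rw [Pi.add_apply, h1', h2', a4]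
      simp) i i
  have hle := conj_diag_le hD hdist i
  rw [hcov, H.cov_r] at hle
  have hqr : IndepFun (fun q : Src nx ny nz × EuclideanSpace ℝ (Fin k) => r i q.1)
      (fun q => innov C h i q.1 - ŵ i q) ν := by
    simp only [hgW]
    refine (hind i).comp (φ := id) (ψ := fun a => (C i a.1.1 - h i a.1.2) - g i (a.2, a.1.2))
      measurable_id ?_
    have := H.measurable_h i
    have := hgm i
    fun_prop
  have hcross : ∫ q, r i q.1 * (innov C h i q.1 - ŵ i q) ∂ν = 0 := by
    have := hqr.integral_mul_eq_mul_integral (hrL i).1 (hqL i).1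
    rw [hr0, zero_mul] at this
    exact this
  have i1 : Integrable (fun q => (innov C h i q.1 - ŵ i q) ^ 2) ν := (hqL i).integrable_sq
  have i2 : Integrable (fun q => r i q.1 * (innov C h i q.1 - ŵ i q)) ν :=
    (hrL i).integrable_mul (hqL i)
  have i3 : Integrable (fun q => r i q.1 ^ 2) ν := (hrL i).integrable_sq
  have e1 : ∀ q, (innov C h i q.1 - ŵ i q + r i q.1) * (innov C h i q.1 - ŵ i q + r i q.1)
      = (innov C h i q.1 - ŵ i q) ^ 2 + 2 * (r i q.1 * (innov C h i q.1 - ŵ i q))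
        + r i q.1 ^ 2 := fun q => by ring
  have e2 : ∫ p, r i p * r i p ∂μ = ∫ q, r i q.1 ^ 2 ∂ν := by
    rw [hν.integral_fst ((H.measurable_r i).pow_const 2)]
    simp only [sq]
  simp only [e1] at hle
  rw [integral_add (f := fun q => (innov C h i q.1 - ŵ i q) ^ 2
      + 2 * (r i q.1 * (innov C h i q.1 - ŵ i q))) (i1.add (i2.const_mul 2)) i3,
    integral_add i1 (i2.const_mul 2), integral_const_mul, hcross, e2] at hle
  linarith

/-- An estimator `g (u, z)` of the innovation with mean squared errors at most `m i` bounds the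
information from below. The Donsker-Varadhan inequality is applied to the logarithm of the density
of `N(g i, m i)` with respect to `N(0, s i)` at `w i`, whose exponential integrates to one because
`w` is independent of `(u, z)` under the reference measure. -/
theorem ofReal_le_condMutualInfo (H : IsSplitting μ V s C h ξ r) (hs : ∀ i, s i ≠ 0)
    (hν : IsAdmissible μ ν) {m : Fin nx → ℝ≥0} (hm : ∀ i, m i ≠ 0)
    {g : Fin nx → EuclideanSpace ℝ (Fin k) × EuclideanSpace ℝ (Fin nz) → ℝ}
    (hg : ∀ i, Measurable (g i)) (hgL : ∀ i, MemLp (fun q => g i (q.2, q.1.2.2)) 2 ν)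
    (hle : ∀ i, ∫ q, (innov C h i q.1 - g i (q.2, q.1.2.2)) ^ 2 ∂ν ≤ m i) :
    ENNReal.ofReal (∑ i, Real.log (s i / m i) / 2)
      ≤ condMutualInfo ν (fun p => p.1.2.1) (fun p => p.2) (fun p => p.1.2.2) := by
  have hmp := hν.measurePreserving
  let f : EuclideanSpace ℝ (Fin nz) × EuclideanSpace ℝ (Fin ny) × EuclideanSpace ℝ (Fin k) → ℝ :=
    fun a => ∑ i, gaussLLR (g i (a.2.2, a.1)) (m i) 0 (s i) (C i a.2.1 - h i a.1)
  have hf : Measurable f := by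
    have := H.measurable_h
    refine Finset.measurable_sum _ fun i _ => ?_
    unfold gaussLLR
    fun_prop
  let w : EuclideanSpace ℝ (Fin ny) × EuclideanSpace ℝ (Fin nz) → Fin nx → ℝ :=
    fun b i => C i b.1 - h i b.2
  have hw : Measurable w := by
    have := H.measurable_h
    exact measurable_pi_lambda _ fun i => by fun_prop
  have hwlaw : ν.map (fun q => w (q.1.2.1, q.1.2.2)) = Measure.pi fun i => gaussianReal 0 (s i) := by
    rw [← H.law_w, ← hν.marginal, Measure.map_map ?_ measurable_fst]
    · rfl
    · exact measurable_pi_lambda _ H.measurable_innov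
  have hwind : IndepFun (fun q : Src nx ny nz × EuclideanSpace ℝ (Fin k) => w (q.1.2.1, q.1.2.2))
      (fun q => q.1.2.2) ν := by
    have h1 := H.indep_w
    rw [← hν.marginal, indepFun_map_iff_comp measurable_fst
      (measurable_pi_lambda _ H.measurable_innov) (by fun_prop)] at h1
    exact h1
  let F : (Fin nx → ℝ) × EuclideanSpace ℝ (Fin nz) × EuclideanSpace ℝ (Fin k) → ℝ≥0∞ := fun a =>
    ENNReal.ofReal (Real.exp (∑ i, gaussLLR (g i (a.2.2, a.2.1)) (m i) 0 (s i) (a.1 i)))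
  have hF : Measurable F := by
    refine ENNReal.measurable_ofReal.comp (Real.measurable_exp.comp
      (Finset.measurable_sum _ fun i _ => ?_))
    unfold gaussLLR
    fun_prop
  have hQ := lintegral_reference_of_indepFun (P := ν) (Y := fun q => q.1.2.1) (U := fun q => q.2)
    (Z := fun q => q.1.2.2) (by fun_prop) (by fun_prop) (by fun_prop) hw hwind hF
  have hFint : ∀ b : EuclideanSpace ℝ (Fin nz) × EuclideanSpace ℝ (Fin k),
      ∫⁻ t, F (t, b.1, b.2) ∂(Measure.pi fun i => gaussianReal 0 (s i)) = 1 := by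
    intro b
    have := pi_gaussianReal_eq_withDensity (a := fun i => g i (b.2, b.1)) (b := fun _ => 0) hm hs
    have h1 := congrArg (fun κ : Measure (Fin nx → ℝ) => κ Set.univ) this
    simp only [measure_univ, withDensity_apply _ MeasurableSet.univ, Measure.restrict_univ] at h1
    exact h1.symm
  rw [hwlaw] at hQ
  simp only [hFint, lintegral_one] at hQ
  have : IsProbabilityMeasure (ν.map fun q => (q.1.2.2, q.2)) :=
    Measure.isProbabilityMeasure_map (by fun_prop)
  rw [measure_univ] at hQ
  have hpm : Measurable fun q : Src nx ny nz × EuclideanSpace ℝ (Fin k) =>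
    (q.1.2.2, (q.1.2.1, q.2)) := by fun_prop
  have : IsProbabilityMeasure (ν.map fun q => (q.1.2.2, (q.1.2.1, q.2))) :=
    Measure.isProbabilityMeasure_map hpm.aemeasurable
  have : IsProbabilityMeasure (ν.map fun q => q.1.2.2) :=
    Measure.isProbabilityMeasure_map (by fun_prop)
  have hwL : ∀ i, MemLp (fun q => innov C h i q.1) 2 ν := fun i =>
    (H.memLp_innov i).comp_measurePreserving hmp
  have i1 : ∀ i, Integrable (fun q => (innov C h i q.1 - g i (q.2, q.1.2.2)) ^ 2 / (2 * m i)) ν :=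
    fun i => ((hwL i).sub (hgL i)).integrable_sq.div_const _
  have i2 : ∀ i, Integrable (fun q => (innov C h i q.1 - 0) ^ 2 / (2 * s i)) ν := fun i => by
    simp only [sub_zero]
    exact (hwL i).integrable_sq.div_const _
  have i3 : ∀ i, Integrable (fun q => gaussLLR (g i (q.2, q.1.2.2)) (m i) 0 (s i)
      (innov C h i q.1)) ν := fun i => ((integrable_const _).sub (i1 i)).add (i2 i)
  have hfi : Integrable f (ν.map fun q => (q.1.2.2, (q.1.2.1, q.2))) := by
    rw [integrable_map_measure hf.aestronglyMeasurable hpm.aemeasurable]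
    exact integrable_finsetSum _ fun i _ => i3 i
  have hI : ∫ a, f a ∂(ν.map fun q => (q.1.2.2, (q.1.2.1, q.2)))
      = ∑ i, ∫ q, gaussLLR (g i (q.2, q.1.2.2)) (m i) 0 (s i) (innov C h i q.1) ∂ν := by
    rw [integral_map hpm.aemeasurable hf.aestronglyMeasurable]
    exact integral_finsetSum _ fun i _ => i3 i
  refine le_trans (ENNReal.ofReal_le_ofReal ?_) (ofReal_integral_le_klDiv hf hfi hQ.le)
  rw [hI]
  refine Finset.sum_le_sum fun i _ => ?_
  have e1 : ∫ q, innov C h i q.1 ^ 2 ∂ν = s i := by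
    rw [hν.integral_fst ((H.measurable_innov i).pow_const 2), H.integral_innov_sq]
  unfold gaussLLR
  rw [integral_add (f := fun q => Real.log (s i / m i) / 2
      - (innov C h i q.1 - g i (q.2, q.1.2.2)) ^ 2 / (2 * m i))
      ((integrable_const _).sub (i1 i)) (i2 i),
    integral_sub (integrable_const _) (i1 i)]
  simp only [sub_zero, integral_div, e1, integral_const, probReal_univ, one_smul]
  have hm' : (0 : ℝ) < m i := NNReal.coe_pos.2 (pos_iff_ne_zero.2 (hm i))
  have hs' : (0 : ℝ) < s i := NNReal.coe_pos.2 (pos_iff_ne_zero.2 (hs i))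
  have a1 : (∫ q, (innov C h i q.1 - g i (q.2, q.1.2.2)) ^ 2 ∂ν) / (2 * m i) ≤ 1 / 2 := by
    rw [div_le_div_iff₀ (by positivity) (by positivity)]
    linarith [hle i]
  have a2 : (s i : ℝ) / (2 * s i) = 1 / 2 := by field_simp
  linarith

theorem rate_lower_bound (H : IsSplitting μ V s C h ξ r) (hs : ∀ i, s i ≠ 0)
    (hμ : MemLp (fun p : Src nx ny nz => p.1) 2 μ) (hν : IsAdmissible μ ν)
    {D : Matrix (Fin nx) (Fin nx) ℝ} {t : Fin nx → ℝ≥0} (ht : ∀ i, t i ≠ 0)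
    (hD : V * (D - covXYZ μ) * Vᵀ = diagonal fun i => (t i : ℝ))
    (hdist : (D - condCov ν (fun p => p.1.1) (fun p => (p.2, p.1.2.2))).PosSemidef) :
    ENNReal.ofReal (∑ i, Real.log (s i / min (t i) (s i) : ℝ≥0) / 2)
      ≤ condMutualInfo ν (fun p => p.1.2.1) (fun p => p.2) (fun p => p.1.2.2) := by
  have hmp := hν.measurePreserving
  have hwL : ∀ i, MemLp (fun q => innov C h i q.1) 2 ν := fun i =>
    (H.memLp_innov i).comp_measurePreserving hmp
  have hex : ∀ i, ∃ g : EuclideanSpace ℝ (Fin k) × EuclideanSpace ℝ (Fin nz) → ℝ, Measurable g ∧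
      MemLp (fun q => g (q.2, q.1.2.2)) 2 ν ∧
      ∫ q, (innov C h i q.1 - g (q.2, q.1.2.2)) ^ 2 ∂ν ≤ (min (t i) (s i) : ℝ≥0) := by
    intro i
    rcases le_total (t i) (s i) with hle | hle
    · obtain ⟨g, hgm, hg⟩ := (stronglyMeasurable_condExp (μ := ν)
        (f := fun q => innov C h i q.1) (m := MeasurableSpace.comap
          (fun q : Src nx ny nz × EuclideanSpace ℝ (Fin k) => (q.2, q.1.2.2)) inferInstance)
        ).measurable.exists_eq_measurable_comp
      have hb := integral_sq_innov_sub_condExp_le H hμ hν hD hdist i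
      have hL := (hwL i).condExp (m := MeasurableSpace.comap
          (fun q : Src nx ny nz × EuclideanSpace ℝ (Fin k) => (q.2, q.1.2.2)) inferInstance)
          (by norm_num)
      rw [hg] at hb hL
      refine ⟨g, hgm, hL, ?_⟩
      rw [min_eq_left hle]
      exact hb
    -- without a binding constraint the constant predictor is good enough
    · refine ⟨fun _ => 0, measurable_const, memLp_const 0, ?_⟩
      simp only [sub_zero]
      rw [min_eq_right hle, hν.integral_fst ((H.measurable_innov i).pow_const 2),
        H.integral_innov_sq]
  choose g hgm hgL hle using hex
  have := ofReal_le_condMutualInfo H hs hν (m := fun i => min (t i) (s i))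
    (fun i => (lt_min (pos_iff_ne_zero.2 (ht i)) (pos_iff_ne_zero.2 (hs i))).ne') hgm hgL hle
  simpa using this

end LowerBound

/-! ### Kernels driven by independent noise -/

section NoiseKernel

variable {Ω α β γ : Type*} [MeasurableSpace Ω] [MeasurableSpace α] [MeasurableSpace β]
  [MeasurableSpace γ]

/-- The kernel sending `x` to the law of `G (x, n)`, where the noise `n` has law `N`. -/
noncomputable def noiseKernel (N : Measure β) (G : α × β → γ) : Kernel α γ :=
  (Kernel.id ×ₖ Kernel.const α N).map G

theorem isMarkovKernel_noiseKernel (N : Measure β) [IsProbabilityMeasure N] {G : α × β → γ}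
    (hG : Measurable G) : IsMarkovKernel (noiseKernel N G) :=
  Kernel.IsMarkovKernel.map _ hG

theorem lintegral_noiseKernel {N : Measure β} [SFinite N] {G : α × β → γ} (hG : Measurable G)
    {f : γ → ℝ≥0∞} (hf : Measurable f) (x : α) :
    ∫⁻ c, f c ∂noiseKernel N G x = ∫⁻ n, f (G (x, n)) ∂N := by
  have hfG : Measurable fun b => f (G b) := hf.comp hG
  rw [noiseKernel, Kernel.map_apply _ hG, lintegral_map hf hG, Kernel.prod_apply, Kernel.id_apply,
    Kernel.const_apply, lintegral_prod _ hfG.aemeasurable,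
    lintegral_dirac' _ hfG.lintegral_prod_right']

theorem condDistrib_ae_eq_noiseKernel [StandardBorelSpace γ] [Nonempty γ] {P : Measure Ω}
    [IsProbabilityMeasure P] {X : Ω → α} {N : Ω → β} {U : Ω → γ} {G : α × β → γ}
    (hX : Measurable X) (hN : Measurable N) (hG : Measurable G) (hind : IndepFun X N P)
    (hU : ∀ ω, U ω = G (X ω, N ω)) :
    condDistrib U X P =ᵐ[P.map X] noiseKernel (P.map N) G := by
  have hUm : Measurable U := by rw [funext hU]; fun_prop
  have : IsProbabilityMeasure (P.map N) := Measure.isProbabilityMeasure_map hN.aemeasurable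
  have := isMarkovKernel_noiseKernel (α := α) (P.map N) hG
  have : IsProbabilityMeasure (P.map X) := Measure.isProbabilityMeasure_map hX.aemeasurable
  rw [condDistrib_ae_eq_iff_measure_eq_compProd X hUm.aemeasurable]
  refine Measure.ext_of_lintegral _ fun f hf => ?_
  rw [Measure.lintegral_compProd hf, lintegral_map hf (by fun_prop)]
  have e1 : ∀ x, ∫⁻ c, f (x, c) ∂noiseKernel (P.map N) G x = ∫⁻ n, f (x, G (x, n)) ∂P.map N :=
    fun x => lintegral_noiseKernel hG (f := fun c => f (x, c)) (by fun_prop) x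
  have hm : Measurable fun b : α × β => f (b.1, G b) := by fun_prop
  simp only [e1, hU]
  rw [← lintegral_prod (f := fun b : α × β => f (b.1, G b)) hm.aemeasurable,
    ← (indepFun_iff_map_prod_eq_prod_map_map hX.aemeasurable hN.aemeasurable).1 hind,
    lintegral_map hm (by fun_prop)]

end NoiseKernel

theorem pi_gaussianReal_map_const_add {ι : Type*} [Fintype ι] (c : ι → ℝ) (v : ι → ℝ≥0) :
    (Measure.pi fun i => gaussianReal 0 (v i)).map (fun n i => c i + n i)
      = Measure.pi fun i => gaussianReal (c i) (v i) := by
  have h : ∀ i, (gaussianReal 0 (v i)).map (fun t => c i + t) = gaussianReal (c i) (v i) :=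
    fun i => by rw [gaussianReal_map_const_add, zero_add]
  have : ∀ i, SigmaFinite ((gaussianReal 0 (v i)).map fun t => c i + t) := fun i => by
    rw [h]; infer_instance
  rw [Measure.pi_map_pi (f := fun i t => c i + t) fun i => by fun_prop]
  simp only [h]

/-! ### The Gaussian test channel -/

section TestChannel

variable {nx ny nz : ℕ} {μ : Measure (Src nx ny nz)} {V : Matrix (Fin nx) (Fin nx) ℝ}
  {s : Fin nx → ℝ≥0} {C : Fin nx → EuclideanSpace ℝ (Fin ny) →L[ℝ] ℝ}
  {h ξ : Fin nx → EuclideanSpace ℝ (Fin nz) → ℝ} {r : Fin nx → Src nx ny nz → ℝ}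

/-- The noise `u - a C y` of the channel with gains `a` in the directions `C`. -/
def noise (a : Fin nx → ℝ) (C : Fin nx → EuclideanSpace ℝ (Fin ny) →L[ℝ] ℝ)
    (q : Src nx ny nz × EuclideanSpace ℝ (Fin nx)) (i : Fin nx) : ℝ :=
  q.2 i - a i * C i q.1.2.1

/-- `u - a h (z) = a w + noise`, the part of `u` that is not predicted by `z`. -/
def outInnov (a : Fin nx → ℝ) (h : Fin nx → EuclideanSpace ℝ (Fin nz) → ℝ)
    (q : Src nx ny nz × EuclideanSpace ℝ (Fin nx)) (i : Fin nx) : ℝ :=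
  q.2 i - a i * h i q.1.2.2

/-- `u = a C y + n` with `n` standard Gaussian and independent of `(x, y, z)`. -/
structure IsTestChannel (μ : Measure (Src nx ny nz)) (a : Fin nx → ℝ)
    (C : Fin nx → EuclideanSpace ℝ (Fin ny) →L[ℝ] ℝ)
    (ν : Measure (Src nx ny nz × EuclideanSpace ℝ (Fin nx))) : Prop where
  marginal : ν.map (fun q => q.1) = μ
  indep : IndepFun (fun q => q.1) (noise a C) ν
  law_noise : ν.map (noise a C) = Measure.pi fun _ => gaussianReal 0 1

theorem measurable_noise (a : Fin nx → ℝ) (C : Fin nx → EuclideanSpace ℝ (Fin ny) →L[ℝ] ℝ) :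
    Measurable (noise (nz := nz) a C) :=
  measurable_pi_lambda _ fun i => by unfold noise; fun_prop

theorem measurable_outInnov (a : Fin nx → ℝ) {h : Fin nx → EuclideanSpace ℝ (Fin nz) → ℝ}
    (hh : ∀ i, Measurable (h i)) : Measurable (outInnov (ny := ny) a h) :=
  measurable_pi_lambda _ fun i => by
    have := hh i
    unfold outInnov; fun_prop

/-- The channel output can be defined for every gain by adjoining an independent noise vector. -/
theorem exists_isTestChannel (μ : Measure (Src nx ny nz)) [IsProbabilityMeasure μ] (a : Fin nx → ℝ)
    (C : Fin nx → EuclideanSpace ℝ (Fin ny) →L[ℝ] ℝ) :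
    ∃ ν : Measure (Src nx ny nz × EuclideanSpace ℝ (Fin nx)), IsProbabilityMeasure ν ∧
      IsTestChannel μ a C ν := by
  let γ : Measure (Fin nx → ℝ) := Measure.pi fun _ => gaussianReal 0 1
  let Φ : Src nx ny nz × (Fin nx → ℝ) → Src nx ny nz × EuclideanSpace ℝ (Fin nx) := fun b =>
    (b.1, WithLp.toLp 2 fun i => a i * C i b.1.2.1 + b.2 i)
  have hΦ : Measurable Φ := by fun_prop
  have hn : noise a C ∘ Φ = Prod.snd := by
    ext b i
    simp [noise, Φ]
  have hnm := measurable_noise (nz := nz) a C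
  have hlaw : ((μ.prod γ).map Φ).map (noise a C) = γ := by
    rw [Measure.map_map hnm hΦ, hn, Measure.map_snd_prod, measure_univ, one_smul]
  have hfst : ((μ.prod γ).map Φ).map (fun q => q.1) = μ := by
    rw [Measure.map_map measurable_fst hΦ]
    exact (Measure.map_fst_prod (μ := μ) (ν := γ)).trans (by rw [measure_univ, one_smul])
  have : IsProbabilityMeasure ((μ.prod γ).map Φ) := Measure.isProbabilityMeasure_map hΦ.aemeasurable
  refine ⟨(μ.prod γ).map Φ, this, hfst, ?_, hlaw⟩
  rw [indepFun_map_iff_comp hΦ measurable_fst hnm, hn]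
  exact indepFun_prod measurable_id measurable_id

namespace IsTestChannel

variable {a : Fin nx → ℝ} {ν : Measure (Src nx ny nz × EuclideanSpace ℝ (Fin nx))}

theorem measurePreserving (T : IsTestChannel μ a C ν) :
    MeasurePreserving (fun q : Src nx ny nz × EuclideanSpace ℝ (Fin nx) => q.1) ν μ :=
  ⟨measurable_fst, T.marginal⟩

theorem isAdmissible [IsProbabilityMeasure ν] (T : IsTestChannel μ a C ν) : IsAdmissible μ ν := by
  refine ⟨T.marginal, ?_⟩
  have hnm := measurable_noise (nz := nz) a C
  let G : EuclideanSpace ℝ (Fin ny) × (Fin nx → ℝ) → EuclideanSpace ℝ (Fin nx) := fun b =>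
    WithLp.toLp 2 fun i => a i * C i b.1 + b.2 i
  have hG : Measurable G := by fun_prop
  have hU : ∀ q : Src nx ny nz × EuclideanSpace ℝ (Fin nx), q.2 = G (q.1.2.1, noise a C q) := by
    intro q
    ext i
    simp [noise, G]
  have h1 := condDistrib_ae_eq_noiseKernel (P := ν) (X := fun q => q.1.2.1) (N := noise a C)
    (U := fun q => q.2) (G := G) (by fun_prop) hnm hG
    (T.indep.comp (φ := fun p : Src nx ny nz => p.2.1) (by fun_prop) measurable_id) hU
  have h2 := condDistrib_ae_eq_noiseKernel (P := ν)
    (X := fun q => (q.1.2.1, (q.1.1, q.1.2.2))) (N := noise a C)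
    (U := fun q => q.2) (G := fun b => G (b.1.1, b.2)) (by fun_prop) hnm (by fun_prop)
    (T.indep.comp (φ := fun p : Src nx ny nz => (p.2.1, (p.1, p.2.2))) (by fun_prop)
      measurable_id) hU
  refine CondIndepFun.symm ((condIndepFun_iff_condDistrib_prod_ae_eq_prodMkRight
    (f := fun q : Src nx ny nz × EuclideanSpace ℝ (Fin nx) => q.2)
    (g := fun q => (q.1.1, q.1.2.2)) (k := fun q => q.1.2.1) (μ := ν) (by fun_prop) (by fun_prop)
    (by fun_prop)).2 ?_)
  have h3 : ∀ᵐ b ∂ν.map (fun q => (q.1.2.1, (q.1.1, q.1.2.2))),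
      condDistrib (fun q => q.2) (fun q => q.1.2.1) ν b.1 = noiseKernel (ν.map (noise a C)) G b.1 := by
    have e : ν.map (fun q => q.1.2.1)
        = (ν.map (fun q => (q.1.2.1, (q.1.1, q.1.2.2)))).map Prod.fst := by
      rw [Measure.map_map (by fun_prop) (by fun_prop)]; rfl
    rw [e] at h1
    exact ae_of_ae_map (by fun_prop) h1
  have : IsProbabilityMeasure (ν.map (noise a C)) := Measure.isProbabilityMeasure_map (by fun_prop)
  filter_upwards [h2, h3] with b hb2 hb3
  rw [hb2, Kernel.prodMkRight_apply, hb3]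
  refine Measure.ext_of_lintegral _ fun f hf => ?_
  rw [lintegral_noiseKernel (by fun_prop) hf, lintegral_noiseKernel hG hf]

end IsTestChannel

end TestChannel

/-! ### Distortion and rate of the Gaussian test channel -/

namespace IsTestChannel

variable {nx ny nz : ℕ} {μ : Measure (Src nx ny nz)} {V : Matrix (Fin nx) (Fin nx) ℝ}
  {s m : Fin nx → ℝ≥0} {C : Fin nx → EuclideanSpace ℝ (Fin ny) →L[ℝ] ℝ}
  {h ξ : Fin nx → EuclideanSpace ℝ (Fin nz) → ℝ} {r : Fin nx → Src nx ny nz → ℝ}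
  {a : Fin nx → ℝ} {ν : Measure (Src nx ny nz × EuclideanSpace ℝ (Fin nx))}

/-- The innovation as a random vector on the space that carries the test channel. -/
def innovVec (C : Fin nx → EuclideanSpace ℝ (Fin ny) →L[ℝ] ℝ)
    (h : Fin nx → EuclideanSpace ℝ (Fin nz) → ℝ)
    (q : Src nx ny nz × EuclideanSpace ℝ (Fin nx)) (i : Fin nx) : ℝ := innov C h i q.1

/-- The error `w - a m (a w + n)` of the estimate of the innovation `w` from `a w + n`, for an
estimator gain `a m`. -/
def estErr (C : Fin nx → EuclideanSpace ℝ (Fin ny) →L[ℝ] ℝ)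
    (h : Fin nx → EuclideanSpace ℝ (Fin nz) → ℝ) (a : Fin nx → ℝ) (m : Fin nx → ℝ≥0) :
    Src nx ny nz × EuclideanSpace ℝ (Fin nx) → Fin nx → ℝ :=
  comb (fun i => 1 - a i * m i * a i) (fun i => -(a i * m i)) (innovVec C h) (noise a C)

theorem outInnov_eq_comb :
    outInnov (ny := ny) a h = comb a (fun _ => 1) (innovVec C h) (noise a C) := by
  ext q i
  simp only [outInnov, comb, innovVec, noise, innov]
  ring

theorem innovVec_eq_add (q : Src nx ny nz × EuclideanSpace ℝ (Fin nx)) (i : Fin nx) :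
    innov C h i q.1 = a i * m i * outInnov a h q i + estErr C h a m q i := by
  simp only [outInnov, estErr, comb, innovVec, noise, innov]
  ring

theorem measurable_innovVec (H : IsSplitting μ V s C h ξ r) : Measurable (innovVec C h) :=
  measurable_pi_lambda _ fun i => (H.measurable_innov i).comp measurable_fst

theorem measurable_estErr (H : IsSplitting μ V s C h ξ r) : Measurable (estErr C h a m) :=
  measurable_comb (measurable_innovVec H) (measurable_noise a C)

theorem map_innovVec (T : IsTestChannel μ a C ν) (H : IsSplitting μ V s C h ξ r) :
    ν.map (innovVec C h) = Measure.pi fun i => gaussianReal 0 (s i) := by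
  rw [← H.law_w, ← T.marginal,
    Measure.map_map (measurable_pi_lambda _ H.measurable_innov) measurable_fst]
  rfl

theorem indepFun_innovVec_noise (T : IsTestChannel μ a C ν) (H : IsSplitting μ V s C h ξ r) :
    IndepFun (innovVec C h) (noise a C) ν :=
  T.indep.comp (φ := fun p i => innov C h i p) (measurable_pi_lambda _ H.measurable_innov)
    measurable_id

variable [IsProbabilityMeasure ν]

theorem indepFun_noise_innovVec_z (T : IsTestChannel μ a C ν) (H : IsSplitting μ V s C h ξ r) :
    IndepFun (fun q => (noise a C q, innovVec C h q)) (fun q => q.1.2.2) ν := by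
  have hm : Measurable fun p i => innov C h i p := measurable_pi_lambda _ H.measurable_innov
  refine indepFun_prodMk_of_indepFun (measurable_noise a C) (measurable_innovVec H) (by fun_prop)
    ?_ ?_
  · exact T.indep.symm.comp (φ := id) (ψ := fun p : Src nx ny nz => ((fun i => innov C h i p), p.2.2))
      measurable_id (hm.prodMk (by fun_prop))
  · have h1 := H.indep_w
    rw [← T.marginal, indepFun_map_iff_comp measurable_fst hm (by fun_prop)] at h1
    exact h1

theorem indepFun_outInnov_z (T : IsTestChannel μ a C ν) (H : IsSplitting μ V s C h ξ r) :
    IndepFun (outInnov a h) (fun q => q.1.2.2) ν := by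
  rw [outInnov_eq_comb (C := C)]
  exact (T.indepFun_noise_innovVec_z H).comp
    (φ := fun b : (Fin nx → ℝ) × (Fin nx → ℝ) => fun i => a i * b.2 i + 1 * b.1 i)
    (ψ := id) (by fun_prop) measurable_id

/-- With the gain `a` such that `m (1 + a² s) = s`, the estimate `a m (a w + n)` of `w` is the
conditional mean, so its error is independent of the observation. -/
theorem indepFun_estErr_output (T : IsTestChannel μ a C ν) (H : IsSplitting μ V s C h ξ r)
    (ham : ∀ i, (m i : ℝ) * (1 + a i ^ 2 * s i) = s i) :
    IndepFun (estErr C h a m) (fun q => (q.2, q.1.2.2)) ν := by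
  have hem := measurable_estErr (a := a) (m := m) H
  have h1 : IndepFun (outInnov a h) (estErr C h a m) ν := by
    rw [outInnov_eq_comb (C := C)]
    refine indepFun_comb (measurable_innovVec H) (T.map_innovVec H) (measurable_noise a C)
      T.law_noise (T.indepFun_innovVec_noise H) fun i => ?_
    rw [NNReal.coe_one]
    linear_combination -a i * ham i
  have h2 : IndepFun (fun q => q.1.2.2) (fun q => (outInnov a h q, estErr C h a m q)) ν := by
    rw [outInnov_eq_comb (C := C)]
    exact (T.indepFun_noise_innovVec_z H).symm.comp (φ := id)
      (ψ := fun b : (Fin nx → ℝ) × (Fin nx → ℝ) => ((fun i => a i * b.2 i + 1 * b.1 i),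
        fun i => (1 - a i * m i * a i) * b.2 i + -(a i * m i) * b.1 i))
      measurable_id (by fun_prop)
  have h3 := (indepFun_prodMk_of_indepFun (by fun_prop) (measurable_outInnov a H.measurable_h) hem
    h2 h1).symm
  have hmh := H.measurable_h
  have h4 := h3.comp (φ := id) (ψ := fun b : EuclideanSpace ℝ (Fin nz) × (Fin nx → ℝ) =>
    ((WithLp.toLp 2 fun i => a i * h i b.1 + b.2 i : EuclideanSpace ℝ (Fin nx)), b.1))
    measurable_id (by fun_prop)
  have e : (fun q : Src nx ny nz × EuclideanSpace ℝ (Fin nx) => (q.2, q.1.2.2))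
      = fun q => ((WithLp.toLp 2 fun i => a i * h i q.1.2.2 + outInnov a h q i), q.1.2.2) := by
    refine funext fun q => Prod.ext ?_ rfl
    ext i
    simp [outInnov]
  rw [e]
  exact h4

theorem integral_estErr_mul_estErr (T : IsTestChannel μ a C ν) (H : IsSplitting μ V s C h ξ r)
    (ham : ∀ i, (m i : ℝ) * (1 + a i ^ 2 * s i) = s i) (i j : Fin nx) :
    ∫ q, estErr C h a m q i * estErr C h a m q j ∂ν = if i = j then (m i : ℝ) else 0 := by
  unfold estErr
  rw [integral_comb_mul_comb (measurable_innovVec H) (T.map_innovVec H) (measurable_noise a C)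
    T.law_noise (T.indepFun_innovVec_noise H)]
  refine if_congr Iff.rfl ?_ rfl
  rw [NNReal.coe_one]
  linear_combination (a i ^ 2 * m i - 1) * ham i

theorem indepFun_residual_estErr (T : IsTestChannel μ a C ν) (H : IsSplitting μ V s C h ξ r) :
    IndepFun (fun q i => r i q.1) (fun q => (estErr C h a m q, q.2, q.1.2.2)) ν := by
  have hh := H.measurable_h
  exact (T.isAdmissible.indepFun (measurable_pi_lambda _ H.measurable_r) H.indep_r).comp (φ := id)
    (ψ := fun b : (EuclideanSpace ℝ (Fin ny) × EuclideanSpace ℝ (Fin nz)) ×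
      EuclideanSpace ℝ (Fin nx) => ((fun i => (1 - a i * m i * a i) * (C i b.1.1 - h i b.1.2)
        + -(a i * m i) * (b.2 i - a i * C i b.1.1)), b.2, b.1.2))
    measurable_id (by fun_prop)

/-- The reconstruction error of the transformed source is the estimation error of the innovation
plus the residual; it is independent of the observation `(u, z)`. -/
theorem indepFun_error_output (T : IsTestChannel μ a C ν) (H : IsSplitting μ V s C h ξ r)
    (ham : ∀ i, (m i : ℝ) * (1 + a i ^ 2 * s i) = s i) :
    IndepFun (fun q => ((fun i => r i q.1), estErr C h a m q)) (fun q => (q.2, q.1.2.2)) ν :=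
  indepFun_prodMk_of_indepFun
    ((measurable_pi_lambda _ H.measurable_r).comp measurable_fst) (measurable_estErr H)
    (by fun_prop) (T.indepFun_residual_estErr H) (T.indepFun_estErr_output H ham)

theorem integral_error_mul_error (T : IsTestChannel μ a C ν) (H : IsSplitting μ V s C h ξ r)
    (ham : ∀ i, (m i : ℝ) * (1 + a i ^ 2 * s i) = s i) (i j : Fin nx) :
    ∫ q, (estErr C h a m q i + r i q.1) * (estErr C h a m q j + r j q.1) ∂ν
      = (diagonal fun i => (m i : ℝ)) i j + (V * covXYZ μ * Vᵀ) i j := by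
  have hmp := T.measurePreserving
  have hrL : ∀ i, MemLp (fun q => r i q.1) 2 ν := fun i =>
    (H.memLp_r i).comp_measurePreserving hmp
  have hqL : ∀ i, MemLp (fun q => estErr C h a m q i) 2 ν := fun i =>
    memLp_comb (measurable_innovVec H) (T.map_innovVec H) (measurable_noise a C) T.law_noise i
  have hq0 : ∀ i, ∫ q, estErr C h a m q i ∂ν = 0 := fun i =>
    integral_comb (measurable_innovVec H) (T.map_innovVec H) (measurable_noise a C) T.law_noise i
  have hrq : ∀ i j, ∫ q, estErr C h a m q i * r j q.1 ∂ν = 0 := fun i j => by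
    have h1 : IndepFun (fun q : Src nx ny nz × EuclideanSpace ℝ (Fin nx) => r j q.1)
        (fun q => estErr C h a m q i) ν :=
      (T.indepFun_residual_estErr H).comp (φ := fun t : Fin nx → ℝ => t j)
        (ψ := fun b : (Fin nx → ℝ) × EuclideanSpace ℝ (Fin nx) × EuclideanSpace ℝ (Fin nz) => b.1 i)
        (by fun_prop) (by fun_prop)
    have h2 := h1.symm.integral_mul_eq_mul_integral (hqL i).1 (hrL j).1
    rw [hq0, zero_mul] at h2
    exact h2
  have i1 : Integrable (fun q => estErr C h a m q i * estErr C h a m q j) ν :=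
    (hqL i).integrable_mul (hqL j)
  have i2 : Integrable (fun q => estErr C h a m q i * r j q.1) ν := (hqL i).integrable_mul (hrL j)
  have i3 : Integrable (fun q => estErr C h a m q j * r i q.1) ν := (hqL j).integrable_mul (hrL i)
  have i4 : Integrable (fun q => r i q.1 * r j q.1) ν := (hrL i).integrable_mul (hrL j)
  have e : ∀ q, (estErr C h a m q i + r i q.1) * (estErr C h a m q j + r j q.1)
      = estErr C h a m q i * estErr C h a m q j + estErr C h a m q i * r j q.1
        + estErr C h a m q j * r i q.1 + r i q.1 * r j q.1 := fun q => by ring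
  simp only [e]
  rw [integral_add (f := fun q => estErr C h a m q i * estErr C h a m q j
        + estErr C h a m q i * r j q.1 + estErr C h a m q j * r i q.1) ((i1.add i2).add i3) i4,
    integral_add (f := fun q => estErr C h a m q i * estErr C h a m q j
        + estErr C h a m q i * r j q.1) (i1.add i2) i3, integral_add i1 i2, hrq, hrq,
    T.integral_estErr_mul_estErr H ham, H.cov_r, diagonal_apply,
    T.isAdmissible.integral_fst (f := fun p => r i p * r j p)
      ((H.measurable_r i).mul (H.measurable_r j))]
  ring

/-- The error covariance in the diagonalizing coordinates. The conditional one is not random, since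
the error is independent of the observation. -/
theorem conj_condCov (T : IsTestChannel μ a C ν) (H : IsSplitting μ V s C h ξ r)
    (hμ : MemLp (fun p : Src nx ny nz => p.1) 2 μ)
    (ham : ∀ i, (m i : ℝ) * (1 + a i ^ 2 * s i) = s i) :
    V * condCov ν (fun p => p.1.1) (fun p => (p.2, p.1.2.2)) * Vᵀ
        = diagonal (fun i => (m i : ℝ)) + V * covXYZ μ * Vᵀ ∧
      ∀ᵐ q ∂ν, V * condCovGiven ν (fun p => p.1.1) (fun p => (p.2, p.1.2.2)) q * Vᵀ
        = diagonal (fun i => (m i : ℝ)) + V * covXYZ μ * Vᵀ := by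
  have hmp := T.measurePreserving
  have hrL : ∀ i, MemLp (fun q => r i q.1) 2 ν := fun i =>
    (H.memLp_r i).comp_measurePreserving hmp
  have hqL : ∀ i, MemLp (fun q => estErr C h a m q i) 2 ν := fun i =>
    memLp_comb (measurable_innovVec H) (T.map_innovVec H) (measurable_noise a C) T.law_noise i
  have hξL : ∀ i, MemLp (fun q => ξ i q.1.2.2) 2 ν := fun i =>
    (H.memLp_ξ i).comp_measurePreserving hmp
  have hSL : ∀ i, MemLp (fun q => outInnov a h q i) 2 ν := fun i => by
    rw [outInnov_eq_comb (C := C)]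
    exact memLp_comb (measurable_innovVec H) (T.map_innovVec H) (measurable_noise a C) T.law_noise i
  have hh := H.measurable_h
  have hξm := H.measurable_ξ
  have hem := measurable_estErr (a := a) (m := m) H
  have hrm := H.measurable_r
  let W : Src nx ny nz × EuclideanSpace ℝ (Fin nx) →
    EuclideanSpace ℝ (Fin nx) × EuclideanSpace ℝ (Fin nz) := fun p => (p.2, p.1.2.2)
  have hW : Measurable W := by fun_prop
  have hX : MemLp (fun q : Src nx ny nz × EuclideanSpace ℝ (Fin nx) => q.1.1) 2 ν :=
    hμ.comp_measurePreserving hmp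
  let g : Fin nx → EuclideanSpace ℝ (Fin nx) × EuclideanSpace ℝ (Fin nz) → ℝ := fun i b =>
    ξ i b.2 + a i * m i * (b.1 i - a i * h i b.2)
  let e : Fin nx → Src nx ny nz × EuclideanSpace ℝ (Fin nx) → ℝ := fun i q =>
    estErr C h a m q i + r i q.1
  have hg : ∀ i, Measurable (g i) := fun i => by fun_prop
  have hgi : ∀ i, Integrable (fun q => g i (W q)) ν := fun i =>
    ((hξL i).add ((hSL i).const_mul _)).integrable (by norm_num)
  have he : ∀ i, MemLp (e i) 2 ν := fun i => (hqL i).add (hrL i)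
  have hei : ∀ i, Integrable (e i) ν := fun i => (he i).integrable (by norm_num)
  have hemeas : ∀ i, Measurable (e i) := fun i => by fun_prop
  have hd : ∀ q i, ∑ k, V i k * q.1.1 k = g i (W q) + e i q := fun q i => by
    rw [H.eq_add, innovVec_eq_add (a := a) (m := m)]
    simp only [g, e, W, outInnov]
    ring
  have hind := T.indepFun_error_output H ham
  have hce : ∀ i, ν[e i | MeasurableSpace.comap W inferInstance] =ᵐ[ν] 0 := fun i => by
    refine condExp_eq_zero_of_indepFun hW (hemeas i) (hind.comp
      (φ := fun b : (Fin nx → ℝ) × (Fin nx → ℝ) => b.2 i + b.1 i) (ψ := id) (by fun_prop)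
      measurable_id) ?_
    have hr0 : ∫ q, r i q.1 ∂ν = 0 := by
      rw [T.isAdmissible.integral_fst (H.measurable_r i), H.integral_r]
    have hq0 : ∫ q, estErr C h a m q i ∂ν = 0 :=
      integral_comb (measurable_innovVec H) (T.map_innovVec H) (measurable_noise a C) T.law_noise i
    rw [integral_add ((hqL i).integrable (by norm_num)) ((hrL i).integrable (by norm_num)), hq0,
      hr0, add_zero]
  refine ⟨?_, ?_⟩
  · ext i j
    rw [conj_condCov_apply (W := W) (g := g) (e := e) hW hX hg hgi hei hd hce, Matrix.add_apply]
    exact T.integral_error_mul_error H ham i j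
  · have h1 : ∀ i j, ∀ᵐ q ∂ν, (V * condCovGiven ν (fun p => p.1.1) W q * Vᵀ) i j
        = (diagonal fun i => (m i : ℝ)) i j + (V * covXYZ μ * Vᵀ) i j := fun i j => by
      have hee : Measurable fun q => e i q * e j q := (hemeas i).mul (hemeas j)
      have h2 : IndepFun (fun q => e i q * e j q) W ν := hind.comp
        (φ := fun b : (Fin nx → ℝ) × (Fin nx → ℝ) => (b.2 i + b.1 i) * (b.2 j + b.1 j)) (ψ := id)
        (by fun_prop) measurable_id
      have h3 := condExp_indep_eq hee.comap_le hW.comap_le (f := fun q => e i q * e j q)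
        (comap_measurable _).stronglyMeasurable h2
      filter_upwards [h3, conj_condCovGiven_apply (W := W) (g := g) (e := e) hW hX hg hgi hei hd
        hce i j] with q h4 h5
      rw [h5, h4]
      exact T.integral_error_mul_error H ham i j
    filter_upwards [ae_all_iff.2 fun i => ae_all_iff.2 fun j => h1 i j] with q hq
    ext i j
    rw [Matrix.add_apply]
    exact hq i j

/-- The information of the test channel. Given `(y, z)` the output has law `N(a C y, 1)` under the
joint law and `N(a h (z), σ)` under the reference measure, so the density is a product of Gaussian
likelihood ratios. -/
theorem condMutualInfo_eq (T : IsTestChannel μ a C ν) (H : IsSplitting μ V s C h ξ r)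
    {σ : Fin nx → ℝ≥0} (hσ : ∀ i, (σ i : ℝ) = 1 + a i ^ 2 * s i) :
    condMutualInfo ν (fun p => p.1.2.1) (fun p => p.2) (fun p => p.1.2.2)
      = ENNReal.ofReal (∑ i, Real.log (σ i) / 2) := by
  have hσ0 : ∀ i, σ i ≠ 0 := fun i h0 => by
    have := hσ i
    rw [h0, NNReal.coe_zero] at this
    nlinarith [mul_nonneg (sq_nonneg (a i)) (s i).2]
  have hh := H.measurable_h
  have hnm := measurable_noise (nz := nz) a C
  have hSm := measurable_outInnov (ny := ny) a H.measurable_h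
  have hSlaw : ν.map (outInnov a h) = Measure.pi fun i => gaussianReal 0 (σ i) := by
    rw [outInnov_eq_comb (C := C)]
    refine map_comb (measurable_innovVec H) (T.map_innovVec H) hnm T.law_noise
      (T.indepFun_innovVec_noise H) fun i => ?_
    rw [hσ, NNReal.coe_one]
    ring
  let G : EuclideanSpace ℝ (Fin nz) × (Fin nx → ℝ) → EuclideanSpace ℝ (Fin nx) := fun b =>
    WithLp.toLp 2 fun i => a i * h i b.1 + b.2 i
  have hG : Measurable G := by fun_prop
  have hUZ := condDistrib_ae_eq_noiseKernel (P := ν) (X := fun q => q.1.2.2) (N := outInnov a h)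
    (U := fun q => q.2) (G := G) (by fun_prop) hSm hG (T.indepFun_outInnov_z H).symm fun q => by
      ext i; simp [outInnov, G]
  rw [hSlaw] at hUZ
  set κ := condDistrib (fun q : Src nx ny nz × EuclideanSpace ℝ (Fin nx) => q.1.2.1)
    (fun q => q.1.2.2) ν with hκ
  set η := noiseKernel (Measure.pi fun i => gaussianReal 0 (σ i)) G with hη
  have : IsMarkovKernel η := isMarkovKernel_noiseKernel _ hG
  let f : EuclideanSpace ℝ (Fin nz) × EuclideanSpace ℝ (Fin ny) × EuclideanSpace ℝ (Fin nx) → ℝ :=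
    fun b => ∑ i, gaussLLR (a i * C i b.2.1) 1 (a i * h i b.1) (σ i) (b.2.2 i)
  have hf : Measurable f := by
    refine Finset.measurable_sum _ fun i _ => ?_
    unfold gaussLLR
    fun_prop
  have hpm : Measurable fun q : Src nx ny nz × EuclideanSpace ℝ (Fin nx) =>
    (q.1.2.2, (q.1.2.1, q.2)) := by fun_prop
  have hnL := memLp_of_map_eq_pi hnm T.law_noise
  have hSL := memLp_of_map_eq_pi hSm hSlaw
  have i1 : ∀ i, Integrable (fun q => noise a C q i ^ 2 / (2 * ((1 : ℝ≥0) : ℝ))) ν :=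
    fun i => (hnL i).integrable_sq.div_const _
  have i2 : ∀ i, Integrable (fun q => outInnov a h q i ^ 2 / (2 * σ i)) ν :=
    fun i => (hSL i).integrable_sq.div_const _
  have i3 : ∀ i, Integrable (fun q => gaussLLR (a i * C i q.1.2.1) 1 (a i * h i q.1.2.2) (σ i)
    (q.2 i)) ν := fun i => ((integrable_const _).sub (i1 i)).add (i2 i)
  have hfi : Integrable f (ν.map fun q => (q.1.2.2, (q.1.2.1, q.2))) := by
    rw [integrable_map_measure hf.aestronglyMeasurable hpm.aemeasurable]
    exact integrable_finsetSum _ fun i _ => i3 i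
  have hI : ∫ b, f b ∂(ν.map fun q => (q.1.2.2, (q.1.2.1, q.2))) = ∑ i, Real.log (σ i) / 2 := by
    rw [integral_map hpm.aemeasurable hf.aestronglyMeasurable]
    refine (integral_finsetSum _ fun i _ => i3 i).trans (Finset.sum_congr rfl fun i _ => ?_)
    have e1 : ∀ q : Src nx ny nz × EuclideanSpace ℝ (Fin nx),
        gaussLLR (a i * C i q.1.2.1) 1 (a i * h i q.1.2.2) (σ i) (q.2 i)
        = Real.log (σ i / (1 : ℝ≥0)) / 2 - noise a C q i ^ 2 / (2 * ((1 : ℝ≥0) : ℝ))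
          + outInnov a h q i ^ 2 / (2 * σ i) := fun q => rfl
    simp only [e1]
    rw [integral_add (f := fun q => Real.log (σ i / (1 : ℝ≥0)) / 2
        - noise a C q i ^ 2 / (2 * ((1 : ℝ≥0) : ℝ))) ((integrable_const _).sub (i1 i)) (i2 i),
      integral_sub (integrable_const _) (i1 i)]
    simp only [integral_div, integral_sq_of_map_eq_pi hnm T.law_noise,
      integral_sq_of_map_eq_pi hSm hSlaw, integral_const, probReal_univ, one_smul]
    have : (σ i : ℝ) ≠ 0 := NNReal.coe_ne_zero.2 (hσ0 i)
    have e2 : (σ i : ℝ) / (2 * σ i) = 1 / 2 := by field_simp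
    rw [e2]
    norm_num
  have hden : ν.map (fun q => (q.1.2.2, (q.1.2.1, q.2)))
      = (ν.map (fun q => q.1.2.2) ⊗ₘ (κ ×ₖ η)).withDensity
        fun b => ENNReal.ofReal (Real.exp (f b)) := by
    refine Measure.ext_of_lintegral _ fun Φ hΦ => ?_
    have hE : Measurable fun b => ENNReal.ofReal (Real.exp (f b)) := by fun_prop
    have hYZ : ν.map (fun q => q.1.2.2) ⊗ₘ κ = ν.map fun q => (q.1.2.2, q.1.2.1) :=
      compProd_map_condDistrib (by fun_prop)
    -- given `(z, y)` the output `u` has independent Gaussian components under both measures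
    have key : ∀ b : EuclideanSpace ℝ (Fin nz) × EuclideanSpace ℝ (Fin ny),
        ∫⁻ n, Φ (b.1, b.2, WithLp.toLp 2 fun i => a i * C i b.2 + n i)
          ∂(Measure.pi fun _ : Fin nx => gaussianReal 0 1)
        = ∫⁻ t, ENNReal.ofReal (Real.exp (f (b.1, b.2, G (b.1, t)))) * Φ (b.1, b.2, G (b.1, t))
          ∂(Measure.pi fun i => gaussianReal 0 (σ i)) := by
      intro b
      have hΦ' : Measurable fun t : Fin nx → ℝ => Φ (b.1, b.2, WithLp.toLp 2 t) := by fun_prop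
      have hE' : Measurable fun t : Fin nx → ℝ => ENNReal.ofReal (Real.exp
          (∑ i, gaussLLR (a i * C i b.2) 1 (a i * h i b.1) (σ i) (t i))) := by
        unfold gaussLLR; fun_prop
      have a1 := lintegral_map (μ := Measure.pi fun _ : Fin nx => gaussianReal 0 1) hΦ'
        (g := fun n i => a i * C i b.2 + n i) (by fun_prop)
      have a2 := lintegral_map (μ := Measure.pi fun i => gaussianReal 0 (σ i)) (hE'.mul hΦ')
        (g := fun n i => a i * h i b.1 + n i) (by fun_prop)
      rw [pi_gaussianReal_map_const_add] at a1 a2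
      rw [pi_gaussianReal_eq_withDensity (b := fun i => a i * h i b.1) (s := σ)
        (fun _ => one_ne_zero) hσ0, lintegral_withDensity_eq_lintegral_mul _ hE' hΦ', a2] at a1
      exact a1.symm
    have hind : IndepFun (fun q : Src nx ny nz × EuclideanSpace ℝ (Fin nx) => (q.1.2.2, q.1.2.1))
        (noise a C) ν := T.indep.comp (φ := fun p : Src nx ny nz => (p.2.2, p.2.1)) (by fun_prop)
          measurable_id
    have e1 : ∫⁻ b, Φ b ∂ν.map (fun q => (q.1.2.2, (q.1.2.1, q.2)))
        = ∫⁻ b, ∫⁻ n, Φ (b.1, b.2, WithLp.toLp 2 fun i => a i * C i b.2 + n i)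
          ∂(Measure.pi fun _ : Fin nx => gaussianReal 0 1)
          ∂ν.map fun q => (q.1.2.2, q.1.2.1) := by
      have hΨ : Measurable fun b : (EuclideanSpace ℝ (Fin nz) × EuclideanSpace ℝ (Fin ny)) ×
          (Fin nx → ℝ) => Φ (b.1.1, b.1.2, WithLp.toLp 2 fun i => a i * C i b.1.2 + b.2 i) := by
        fun_prop
      rw [← lintegral_prod _ hΨ.aemeasurable, ← T.law_noise,
        ← (indepFun_iff_map_prod_eq_prod_map_map (by fun_prop) hnm.aemeasurable).1 hind,
        lintegral_map hΨ (by fun_prop), lintegral_map hΦ hpm]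
      refine lintegral_congr fun q => ?_
      congr 3
      ext i
      simp [noise]
    have hEΦ := hE.mul hΦ
    rw [e1, lintegral_withDensity_eq_lintegral_mul _ hE hΦ, Measure.lintegral_compProd hEΦ, ← hYZ,
      Measure.lintegral_compProd]
    · refine lintegral_congr fun z => ?_
      rw [Kernel.prod_apply, lintegral_prod _ (by fun_prop)]
      refine lintegral_congr fun y => ?_
      exact (key (z, y)).trans (lintegral_noiseKernel hG (hEΦ.comp (by fun_prop :
        Measurable fun u : EuclideanSpace ℝ (Fin nx) => (z, y, u))) z).symm
    · exact Measurable.lintegral_prod_right' (f := fun b : (EuclideanSpace ℝ (Fin nz) ×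
        EuclideanSpace ℝ (Fin ny)) × (Fin nx → ℝ) =>
          Φ (b.1.1, b.1.2, WithLp.toLp 2 fun i => a i * C i b.1.2 + b.2 i)) (by fun_prop)
  unfold condMutualInfo
  have : IsProbabilityMeasure (ν.map fun q => q.1.2.2) :=
    Measure.isProbabilityMeasure_map (by fun_prop)
  have : IsProbabilityMeasure (ν.map fun q => (q.1.2.2, (q.1.2.1, q.2))) :=
    Measure.isProbabilityMeasure_map (by fun_prop)
  have hQ : ν.map (fun q => q.1.2.2) ⊗ₘ (κ ×ₖ condDistrib (fun q => q.2) (fun q => q.1.2.2) ν)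
      = ν.map (fun q => q.1.2.2) ⊗ₘ (κ ×ₖ η) := by
    refine Measure.compProd_congr ?_
    filter_upwards [hUZ] with z hz
    rw [Kernel.prod_apply, Kernel.prod_apply, hz]
  rw [hQ, klDiv_withDensity_exp hf hfi hden, hI]

end IsTestChannel

/-! ### The rate-distortion function -/

theorem posSemidef_of_conj {n : ℕ} {V A : Matrix (Fin n) (Fin n) ℝ} (hV : IsUnit V.det)
    (h : (V * A * Vᵀ).PosSemidef) : A.PosSemidef := by
  have h1 := h.mul_mul_conjTranspose_same V⁻¹
  have e : V⁻¹ * (V * A * Vᵀ) * (V⁻¹)ᴴ = A := by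
    rw [conjTranspose_eq_transpose_of_trivial, transpose_nonsing_inv]
    have hVt : IsUnit Vᵀ.det := by rwa [det_transpose]
    calc V⁻¹ * (V * A * Vᵀ) * Vᵀ⁻¹ = (V⁻¹ * V) * A * (Vᵀ * Vᵀ⁻¹) := by simp only [mul_assoc]
      _ = A := by rw [nonsing_inv_mul _ hV, mul_nonsing_inv _ hVt, one_mul, mul_one]
  rwa [e] at h1

variable {nx ny nz : ℕ} {μ : Measure (Src nx ny nz)} {D : Matrix (Fin nx) (Fin nx) ℝ}

/-- The almost sure distortion constraint implies the one in the mean, by integration. -/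
theorem posSemidef_sub_condCov {Ω β : Type} [MeasurableSpace Ω] [mβ : MeasurableSpace β] {n : ℕ}
    {P : Measure Ω} [IsProbabilityMeasure P] {X : Ω → EuclideanSpace ℝ (Fin n)} {W : Ω → β}
    (hW : Measurable W) {D : Matrix (Fin n) (Fin n) ℝ}
    (h : ∀ᵐ ω ∂P, (D - condCovGiven P X W ω).PosSemidef) : (D - condCov P X W).PosSemidef := by
  have hcov : ∀ i j, condCov P X W i j = ∫ ω, condCovGiven P X W ω i j ∂P := fun i j =>
    (integral_condExp hW.comap_le).symm
  have hg : ∀ i j, Integrable (fun ω => condCovGiven P X W ω i j) P := fun _ _ =>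
    integrable_condExp
  have hint : ∀ i j, Integrable (fun ω => (D - condCovGiven P X W ω) i j) P := fun i j =>
    (integrable_const (D i j)).sub (hg i j)
  have hsub : ∀ i j, (D - condCov P X W) i j = ∫ ω, (D - condCovGiven P X W ω) i j ∂P :=
    fun i j => by
      simp only [Matrix.sub_apply]
      have := integral_sub (integrable_const (μ := P) (D i j)) (hg i j)
      rw [this, hcov]
      simp
  refine PosSemidef.of_dotProduct_mulVec_nonneg ?_ fun x => ?_
  · ext i j
    rw [conjTranspose_apply, star_trivial, hsub, hsub]
    refine integral_congr_ae ?_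
    filter_upwards [h] with ω hω
    have := hω.1.apply i j
    rwa [star_trivial] at this
  · have e : ∀ A : Matrix (Fin n) (Fin n) ℝ,
        star x ⬝ᵥ (A *ᵥ x) = ∑ i, ∑ j, x i * x j * A i j := fun A => by
      simp only [dotProduct, mulVec, star_trivial, Finset.mul_sum]
      exact Finset.sum_congr rfl fun i _ => Finset.sum_congr rfl fun j _ => by ring
    have e2 : ∑ i, ∑ j, x i * x j * (D - condCov P X W) i j
        = ∫ ω, ∑ i, ∑ j, x i * x j * (D - condCovGiven P X W ω) i j ∂P := by
      rw [integral_finsetSum _ fun i _ => integrable_finsetSum _ fun j _ =>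
        (hint i j).const_mul _]
      refine Finset.sum_congr rfl fun i _ => ?_
      rw [integral_finsetSum _ fun j _ => (hint i j).const_mul _]
      exact Finset.sum_congr rfl fun j _ => by rw [integral_const_mul, hsub]
    rw [e, e2]
    refine integral_nonneg_of_ae ?_
    filter_upwards [h] with ω hω
    have := hω.dotProduct_mulVec_nonneg x
    rwa [e] at this

theorem feasibleRatesAE_subset : feasibleRatesAE μ D ⊆ feasibleRates μ D := by
  rintro ρ ⟨k, ν, hν, hadm, hdist, hρ⟩
  exact ⟨k, ν, hν, hadm, posSemidef_sub_condCov (by fun_prop) hdist, hρ⟩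

/-- Coordinates in which both matrices are diagonal, with diagonals `t` and `s`, and in which the
claimed rate is a sum over the components. -/
theorem exists_coordinates (hfull : (covXZ μ - covXYZ μ).PosDef) (hD : (D - covXYZ μ).PosDef) :
    ∃ (V : Matrix (Fin nx) (Fin nx) ℝ) (t s : Fin nx → ℝ≥0), IsUnit V.det ∧
      (∀ i, t i ≠ 0) ∧ (∀ i, s i ≠ 0) ∧
      V * (D - covXYZ μ) * Vᵀ = diagonal (fun i => (t i : ℝ)) ∧
      V * (covXZ μ - covXYZ μ) * Vᵀ = diagonal (fun i => (s i : ℝ)) ∧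
      1 / 2 * Real.log ((covXZ μ - covXYZ μ).det /
        (matrixMin (D - covXYZ μ) (covXZ μ - covXYZ μ)).det)
        = ∑ i, Real.log (s i / min (t i) (s i) : ℝ≥0) / 2 := by
  obtain ⟨V, lam, lam', hV, hl, hl', h1, h2, hdet⟩ :=
    exists_simultaneous_diagonalization hD hfull
  lift lam to Fin nx → ℝ≥0 using fun i => (hl i).le
  lift lam' to Fin nx → ℝ≥0 using fun i => (hl' i).le
  have hl0 : ∀ i, lam i ≠ 0 := fun i h0 => by have := hl i; simp [h0] at this
  have hl0' : ∀ i, lam' i ≠ 0 := fun i h0 => by have := hl' i; simp [h0] at this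
  refine ⟨V, lam, lam', hV, hl0, hl0', h1, h2, ?_⟩
  rw [hdet, Real.log_prod fun i _ => ?_, Finset.mul_sum]
  · refine Finset.sum_congr rfl fun i _ => ?_
    push_cast
    ring
  · exact (div_pos (hl' i) (lt_min (hl i) (hl' i))).ne'

end RemoteWynerZiv

open RemoteWynerZiv

theorem theorem1 {nx ny nz : ℕ} (μ : Measure (RemoteWynerZiv.Src nx ny nz)) [IsGaussian μ]
    (hfull : (RemoteWynerZiv.covXZ μ - RemoteWynerZiv.covXYZ μ).PosDef)
    (D : Matrix (Fin nx) (Fin nx) ℝ) (hD : (D - RemoteWynerZiv.covXYZ μ).PosDef) :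
    IsLeast (RemoteWynerZiv.feasibleRates μ D)
      ((1 / 2 * Real.log ((RemoteWynerZiv.covXZ μ - RemoteWynerZiv.covXYZ μ).det /
        (RemoteWynerZiv.matrixMin (D - RemoteWynerZiv.covXYZ μ)
          (RemoteWynerZiv.covXZ μ - RemoteWynerZiv.covXYZ μ)).det) : ℝ) : EReal) ∧
    IsLeast (RemoteWynerZiv.feasibleRatesAE μ D)
      ((1 / 2 * Real.log ((RemoteWynerZiv.covXZ μ - RemoteWynerZiv.covXYZ μ).det /
        (RemoteWynerZiv.matrixMin (D - RemoteWynerZiv.covXYZ μ)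
          (RemoteWynerZiv.covXZ μ - RemoteWynerZiv.covXYZ μ)).det) : ℝ) : EReal) := by
  obtain ⟨V, t, s, hV, ht, hs, hVD, hVS, hval⟩ := exists_coordinates hfull hD
  obtain ⟨C, h, ξ, r, H⟩ := exists_isSplitting μ V s hVS
  have hμ : MemLp (fun p : Src nx ny nz => p.1) 2 μ :=
    (ContinuousLinearMap.fst ℝ (EuclideanSpace ℝ (Fin nx))
      (EuclideanSpace ℝ (Fin ny) × EuclideanSpace ℝ (Fin nz))).comp_memLp'
      (IsGaussian.memLp_two_id (μ := μ))
  rw [hval]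
  set m : Fin nx → ℝ≥0 := fun i => min (t i) (s i) with hm
  have hm0 : ∀ i, 0 < m i := fun i => lt_min (pos_iff_ne_zero.2 (ht i)) (pos_iff_ne_zero.2 (hs i))
  have hms : ∀ i, m i ≤ s i := fun i => min_le_right _ _
  have hm0' : ∀ i, (0 : ℝ) < m i := fun i => NNReal.coe_pos.2 (hm0 i)
  have hs0 : ∀ i, (0 : ℝ) < s i := fun i => NNReal.coe_pos.2 (pos_iff_ne_zero.2 (hs i))
  have hnn : 0 ≤ ∑ i, Real.log (s i / m i : ℝ≥0) / 2 := Finset.sum_nonneg fun i _ => by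
    refine div_nonneg (Real.log_nonneg ?_) zero_le_two
    rw [NNReal.coe_div, one_le_div (hm0' i)]
    exact_mod_cast hms i
  have hcoe : ((∑ i, Real.log (s i / m i : ℝ≥0) / 2 : ℝ) : EReal)
      = (ENNReal.ofReal (∑ i, Real.log (s i / m i : ℝ≥0) / 2) : ENNReal) := by
    rw [EReal.coe_ennreal_ofReal, max_eq_left hnn]
  have hlow : ∀ ρ ∈ feasibleRates μ D,
      ((∑ i, Real.log (s i / m i : ℝ≥0) / 2 : ℝ) : EReal) ≤ ρ := by
    rintro ρ ⟨k, ν, hν, hadm, hdist, rfl⟩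
    rw [hcoe]
    exact EReal.coe_ennreal_le_coe_ennreal_iff.2 (rate_lower_bound H hs hμ hadm ht hVD hdist)
  -- the gain for which the channel leaves the error variance `m i` in the `i`-th direction
  let a : Fin nx → ℝ := fun i => √(1 / m i - 1 / s i)
  have ha : ∀ i, 1 + a i ^ 2 * s i = s i / m i := fun i => by
    have h1 : (0 : ℝ) ≤ 1 / m i - 1 / s i :=
      sub_nonneg.2 (one_div_le_one_div_of_le (hm0' i) (by exact_mod_cast hms i))
    have h2 := (hs0 i).ne'
    have h3 := (hm0' i).ne'
    rw [Real.sq_sqrt h1]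
    field_simp
    ring
  obtain ⟨ν, hν, T⟩ := exists_isTestChannel μ a C
  obtain ⟨hc, hcae⟩ := T.conj_condCov H (m := m) hμ fun i => by
    rw [ha, mul_div_cancel₀ _ (hm0' i).ne']
  have hrate : ((∑ i, Real.log (s i / m i : ℝ≥0) / 2 : ℝ) : EReal) = rate ν := by
    rw [hcoe, rate, T.condMutualInfo_eq H (σ := fun i => s i / m i) fun i => by
      rw [ha, NNReal.coe_div]]
  have hpsd : ∀ S : Matrix (Fin nx) (Fin nx) ℝ,
      V * S * Vᵀ = diagonal (fun i => (m i : ℝ)) + V * covXYZ μ * Vᵀ → (D - S).PosSemidef := by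
    intro S hS
    refine posSemidef_of_conj hV ?_
    have e : V * (D - S) * Vᵀ = diagonal fun i => (t i : ℝ) - m i := by
      rw [← diagonal_sub, ← hVD, mul_sub, sub_mul, mul_sub, sub_mul, hS]
      abel
    rw [e, posSemidef_diagonal_iff]
    exact fun i => sub_nonneg.2 (by exact_mod_cast min_le_left (t i) (s i))
  have hAE : ((∑ i, Real.log (s i / m i : ℝ≥0) / 2 : ℝ) : EReal) ∈ feasibleRatesAE μ D :=
    ⟨nx, ν, hν, T.isAdmissible, hcae.mono fun q hq => hpsd _ hq, hrate⟩
  exact ⟨⟨feasibleRatesAE_subset hAE, hlow⟩, hAE, fun ρ hρ => hlow ρ (feasibleRatesAE_subset hρ)⟩
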